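/- **Definitions.** An *MT-algebra* is a complete Boolean algebra $M$ with an operator $\square$ such that $\square 1=1$, $\square(a\wedge b)=\square a\wedge\square b$, $\square a\le a$ and $\square a\le\square\square a$. An *MT-morphism* $f:M\to N$ is a complete Boolean homomorphism with $f(\square a)\le\square f(a)$. Put $\diamond a=\neg\square\neg a$. An element $a\in M$ is *open* if $a=\square a$, *closed* if $a=\diamond a$, *saturated* if it is a meet of open elements, and *compact* if whenever $a\le\bigvee S$ with $S$ a set of open elements, then $a\le\bigvee T$ for some finite $T\subseteq S$. Let $\mathcal O(M)$ be the frame of open elements. $M$ is *sober* if every element is a join of elements of the form $s\wedge c$ with $s$ saturated and $c$ closed, and every join-irreducible element of the lattice of closed elements is $\diamond x$ for some atom $x$; $M$ is *spatial* if it is atomic; $M$ is *locally compact* if every open $u$ is the join of those open $v$ for which there is a compact $k$ with $v\le k\le u$. A locally compact sober $M$ is *stably locally compact* if the meet of two compact saturated elements is compact saturated, and *stably compact* if moreover $1$ is compact. An MT-morphism is *proper* if it maps compact saturated elements to compact saturated elements. In a frame, $a\ll b$ means that $b\le\bigvee S$ implies $a\le\bigvee T$ for some finite $T\subseteq S$.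 A frame is *continuous* if $a=\bigvee\{x: x\ll a\}$ for all $a$; *stably continuous* if moreover $a\ll b$ and $a\ll c$ imply $a\ll b\wedge c$; *stably compact* if it is stably continuous and compact. A frame homomorphism is *proper* if it preserves $\ll$. A locally compact sober ($T_0$) space is *stably locally compact* if the intersection of two compact saturated sets is compact saturated (saturated: an intersection of open sets), and *stably compact* if it is moreover compact. A continuous map is *proper* if preimages of compact saturated sets are compact. Let $\mathbf{LCSobMT}\supseteq\mathbf{StLCMT}\supseteq\mathbf{StKMT}$ be the categories of locally compact sober, stably locally compact, and stably compact MT-algebras with proper MT-morphisms, and let $\mathbf{LCSobSMT}$, $\mathbf{StLCSMT}$, $\mathbf{StKSMT}$ be their full subcategories of spatial algebras. Let $\mathbf{CFrm}\supseteq\mathbf{StCFrm}\supseteq\mathbf{StKFrm}$ be the categories of continuous, stably continuous, and stably compact frames with proper frame homomorphisms, and $\mathbf{LCSob}\supseteq\mathbf{StLCSob}\supseteq\mathbf{StKSob}$ the categories of locally compact sober, stably locally compact, and stably compact spaces with proper maps. **Functors.** $\mathcal O$ sends an MT-algebra to its frame of open elements and an MT-morphism to its restriction; $\mathcal P$ sends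 a space $X$ to its powerset with the interior operator, and $f$ to $f^{-1}$; $\mathrm{at}$ sends $M$ to its set of atoms with the topology $\{\eta(a): a\in\mathcal O(M)\}$, where $\eta(a)=\{x\in \mathrm{at}(M): x\le a\}$, and $f$ to its left adjoint restricted to atoms; $\Omega$ sends a space to its frame of opens; $\mathrm{pt}$ sends a frame $L$ to the space of its points (completely prime filters) with the topology $\{\zeta(a): a\in L\}$, $\zeta(a)=\{p: a\in p\}$. For $x\in\mathrm{at}(M)$ put $\vartheta(x)=\{u\in\mathcal O(M): x\le u\}\in\mathrm{pt}(\mathcal O(M))$. **Theorem.** 1. $\mathcal O$ and $\mathcal P\circ\mathrm{pt}$ restrict to functors between $\mathbf{LCSobMT}$ and $\mathbf{CFrm}$ and are adjoint there, $\mathcal O$ on the left, with unit $a\mapsto\{\vartheta(x): x\in\mathrm{at}(M),\ x\le a\}$ and counit $\zeta^{-1}$. This adjunction restricts to an equivalence between $\mathbf{LCSobSMT}$ and $\mathbf{CFrm}$. $\mathrm{at}$ and $\mathcal P$ restrict to a dual adjunction between $\mathbf{LCSobMT}$ and $\mathbf{LCSob}$, with units $\eta$ and $x\mapsto\{x\}$,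 which restricts to a dual equivalence between $\mathbf{LCSobSMT}$ and $\mathbf{LCSob}$. 2. The adjunction of (1) restricts to an adjunction between $\mathbf{StLCMT}$ and $\mathbf{StCFrm}$, and the equivalence to an equivalence between $\mathbf{StLCSMT}$ and $\mathbf{StCFrm}$. The dual adjunction of (1) restricts to a dual adjunction between $\mathbf{StLCMT}$ and $\mathbf{StLCSob}$, and the dual equivalence to a dual equivalence between $\mathbf{StLCSMT}$ and $\mathbf{StLCSob}$. Moreover $\mathrm{pt}$ and $\Omega$ restrict to a dual equivalence between $\mathbf{StCFrm}$ and $\mathbf{StLCSob}$, with units $\zeta$ and $x\mapsto\{U: x\in U\}$. 3. The adjunction of (2) restricts to an adjunction between $\mathbf{StKMT}$ and $\mathbf{StKFrm}$, and the equivalence to an equivalence between $\mathbf{StKSMT}$ and $\mathbf{StKFrm}$. The dual adjunction of (2) restricts to a dual adjunction between $\mathbf{StKMT}$ and $\mathbf{StKSob}$, and the dual equivalence to a dual equivalence between $\mathbf{StKSMT}$ and $\mathbf{StKSob}$. Moreover $\mathrm{pt}$ and $\Omega$ restrict to a dual equivalence between $\mathbf{StKFrm}$ and $\mathbf{StKSob}$,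 with units $\zeta$ and $x\mapsto\{U: x\in U\}$. -/

import Mathlib

open CategoryTheory Opposite

universe u v

namespace MTDuality

/-! ### MT-algebras and MT-morphisms -/

/-- An MT-algebra: a complete Boolean algebra with an interior operator `box`. -/
class MTAlgebra (M : Type u) extends CompleteBooleanAlgebra M where
  box : M → M
  box_top : box ⊤ = ⊤
  box_inf : ∀ a b : M, box (a ⊓ b) = box a ⊓ box b
  box_le : ∀ a : M, box a ≤ a
  box_le_box_box : ∀ a : M, box a ≤ box (box a)

/-- An MT-morphism: a complete Boolean homomorphism (a map preserving all joins and all meets,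
hence complements) with `f (□ a) ≤ □ (f a)`. -/
structure MTHom (M : Type u) (N : Type v) [MTAlgebra M] [MTAlgebra N] extends
    CompleteLatticeHom M N where
  map_box_le' : ∀ a : M, toFun (MTAlgebra.box a) ≤ MTAlgebra.box (toFun a)

instance {M : Type u} {N : Type v} [MTAlgebra M] [MTAlgebra N] : FunLike (MTHom M N) M N where
  coe f := f.toFun
  coe_injective := by
    intro f g h
    obtain ⟨f, hf⟩ := f
    obtain ⟨g, hg⟩ := g
    have : f = g := DFunLike.coe_injective h
    subst this
    rfl

instance {M : Type u} {N : Type v} [MTAlgebra M] [MTAlgebra N] :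
    CompleteLatticeHomClass (MTHom M N) M N where
  map_sSup f := f.map_sSup'
  map_sInf f := f.map_sInf'

/-- The identity MT-morphism. -/
def MTHom.id (M : Type u) [MTAlgebra M] : MTHom M M where
  toCompleteLatticeHom := CompleteLatticeHom.id M
  map_box_le' _ := le_rfl

theorem MTHom.map_box_le {M : Type u} {N : Type v} [MTAlgebra M] [MTAlgebra N] (f : MTHom M N)
    (a : M) : f (MTAlgebra.box a) ≤ MTAlgebra.box (f a) := f.map_box_le' a

/-- Composition of MT-morphisms. -/
def MTHom.comp {M N K : Type u} [MTAlgebra M] [MTAlgebra N] [MTAlgebra K]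
    (g : MTHom N K) (f : MTHom M N) : MTHom M K where
  toCompleteLatticeHom := g.toCompleteLatticeHom.comp f.toCompleteLatticeHom
  map_box_le' a :=
    le_trans (OrderHomClass.mono g (f.map_box_le a)) (g.map_box_le (f a))

/-- The category of MT-algebras and MT-morphisms. -/
structure MT : Type (u + 1) where
  of ::
  carrier : Type u
  [str : MTAlgebra carrier]

attribute [instance] MT.str

instance : CoeSort MT.{u} (Type u) := ⟨MT.carrier⟩

/-- Morphisms of `MT`. -/
@[ext]
structure MT.Hom (M N : MT.{u}) where
  hom' : MTHom M N

instance : Category MT.{u} where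
  Hom M N := MT.Hom M N
  id M := ⟨MTHom.id M⟩
  comp f g := ⟨g.hom'.comp f.hom'⟩

instance : ConcreteCategory MT.{u} (fun M N => MTHom M N) where
  hom := MT.Hom.hom'
  ofHom := MT.Hom.mk

section Elements

variable {M : Type u} [MTAlgebra M]

/-- `a` is open if `a = □ a`. -/
def IsOpenElt (a : M) : Prop := a = MTAlgebra.box a

/-- The closure operator `◇ a = ¬ □ ¬ a`. -/
def diamond (a : M) : M := (MTAlgebra.box aᶜ)ᶜ

/-- `a` is closed if `a = ◇ a`. -/
def IsClosedElt (a : M) : Prop := a = diamond a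

/-- `a` is saturated if it is a meet of open elements. -/
def IsSaturatedElt (a : M) : Prop := ∃ S : Set M, (∀ u ∈ S, IsOpenElt u) ∧ a = sInf S

/-- `a` is weakly locally closed if it is a meet of a saturated and a closed element. -/
def IsWeaklyLocallyClosedElt (a : M) : Prop :=
  ∃ s c : M, IsSaturatedElt s ∧ IsClosedElt c ∧ a = s ⊓ c

/-- `a` is compact if every cover of `a` by open elements has a finite subcover. -/
def IsCompactElt (a : M) : Prop :=
  ∀ S : Set M, (∀ u ∈ S, IsOpenElt u) → a ≤ sSup S → ∃ T ⊆ S, T.Finite ∧ a ≤ sSup T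

/-- The compact saturated elements. -/
def IsKS (a : M) : Prop := IsCompactElt a ∧ IsSaturatedElt a

/-- `a ◁ b` if there is a compact `k` with `a ≤ k ≤ b`. -/
def Nested (a b : M) : Prop := ∃ k : M, IsCompactElt k ∧ a ≤ k ∧ k ≤ b

variable (M)

/-- `T₀`: the weakly locally closed elements join-generate `M`. -/
def IsT0 : Prop :=
  ∀ a : M, ∃ S : Set M, (∀ b ∈ S, IsWeaklyLocallyClosedElt b) ∧ a = sSup S

/-- `p` is a join-irreducible element of the lattice of closed elements. -/
def IsJoinIrreducibleClosed (p : M) : Prop :=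
  IsClosedElt p ∧ p ≠ ⊥ ∧ ∀ a b : M, IsClosedElt a → IsClosedElt b → p = a ⊔ b → p = a ∨ p = b

/-- Sober MT-algebras: `T₀`, and every join-irreducible closed element is the closure of an
atom. -/
def IsSober : Prop :=
  IsT0 M ∧ ∀ p : M, IsJoinIrreducibleClosed M p → ∃ x : M, IsAtom x ∧ p = diamond x

/-- Every open `u` is the join of the open `v ◁ u`. -/
def IsLocallyCompact : Prop :=
  ∀ u : M, IsOpenElt u → u = sSup {v : M | IsOpenElt v ∧ Nested v u}

end Elements

/-! ### The frame of open elements -/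

section Opens

variable (M : Type u) [MTAlgebra M]

/-- The open elements of `M`. -/
@[ext]
structure OpenElts : Type u where
  val : M
  property : IsOpenElt val

variable {M}

theorem box_mono {a b : M} (h : a ≤ b) : MTAlgebra.box a ≤ MTAlgebra.box b := by
  have := MTAlgebra.box_inf a b
  rw [inf_eq_left.2 h] at this
  exact inf_eq_left.1 this.symm

theorem isOpenElt_of_le {a : M} (h : a ≤ MTAlgebra.box a) : IsOpenElt a :=
  le_antisymm h (MTAlgebra.box_le a)

theorem isOpenElt_box (a : M) : IsOpenElt (MTAlgebra.box a) :=
  isOpenElt_of_le (MTAlgebra.box_le_box_box a)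

theorem isOpenElt_inf {a b : M} (ha : IsOpenElt a) (hb : IsOpenElt b) : IsOpenElt (a ⊓ b) := by
  unfold IsOpenElt at *
  rw [MTAlgebra.box_inf, ← ha, ← hb]

theorem isOpenElt_top : IsOpenElt (⊤ : M) := MTAlgebra.box_top.symm

theorem isOpenElt_sSup {S : Set M} (hS : ∀ u ∈ S, IsOpenElt u) : IsOpenElt (sSup S) :=
  isOpenElt_of_le (sSup_le fun u hu => (hS u hu).le.trans (box_mono (le_sSup hu)))

/-- The order of `M`, restricted to the open elements. -/
instance : PartialOrder (OpenElts M) :=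
  PartialOrder.lift OpenElts.val fun _ _ h => OpenElts.ext h

instance : SupSet (OpenElts M) where
  sSup S := ⟨sSup (OpenElts.val '' S), isOpenElt_sSup (by rintro _ ⟨u, _, rfl⟩; exact u.property)⟩

theorem isLUB_sSup_openElts (S : Set (OpenElts M)) : IsLUB S (sSup S) :=
  ⟨fun u hu => (le_sSup ⟨u, hu, rfl⟩ : u.1 ≤ sSup (OpenElts.val '' S)),
    fun b hb => (sSup_le (by rintro _ ⟨u, hu, rfl⟩; exact hb hu) :
      sSup (OpenElts.val '' S) ≤ b.1)⟩

instance : CompleteLattice (OpenElts M) where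
  __ := completeLatticeOfSup (OpenElts M) isLUB_sSup_openElts
  inf a b := ⟨a.1 ⊓ b.1, isOpenElt_inf a.property b.property⟩
  inf_le_left a b := (inf_le_left : a.val ⊓ b.1 ≤ a.1)
  inf_le_right a b := (inf_le_right : a.val ⊓ b.1 ≤ b.1)
  le_inf a b c h₁ h₂ := (le_inf h₁ h₂ : a.val ≤ b.1 ⊓ c.1)
  top := ⟨⊤, isOpenElt_top⟩
  le_top a := (le_top : a.val ≤ ⊤)

theorem OpenElts.coe_sSup (S : Set (OpenElts M)) : (sSup S).1 = sSup (OpenElts.val '' S) := rfl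

theorem OpenElts.coe_inf (a b : OpenElts M) : (a ⊓ b).1 = a.val ⊓ b.1 := rfl

theorem OpenElts.coe_top : (⊤ : OpenElts M).1 = ⊤ := rfl

instance : Order.Frame (OpenElts M) := .ofMinimalAxioms
  { inf_sSup_le_iSup_inf := by
      intro a S
      change a.val ⊓ sSup (OpenElts.val '' S) ≤ (⨆ b ∈ S, a ⊓ b : OpenElts M).1
      rw [inf_sSup_eq]
      refine iSup₂_le ?_
      rintro _ ⟨b, hb, rfl⟩
      exact (le_iSup₂_of_le b hb le_rfl : a ⊓ b ≤ ⨆ b ∈ S, a ⊓ b) }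

end Opens

/-- An MT-morphism restricts to a frame homomorphism between the open elements. -/
def MTHom.onOpens {M N : Type u} [MTAlgebra M] [MTAlgebra N] (f : MTHom M N) :
    FrameHom (OpenElts M) (OpenElts N) where
  toFun a := ⟨f a.1, isOpenElt_of_le
    ((congrArg f a.property).le.trans (f.map_box_le a.1))⟩
  map_inf' a b := OpenElts.ext (map_inf f a.val b.1)
  map_top' := OpenElts.ext (map_top f)
  map_sSup' S := OpenElts.ext (by
    change f (sSup (OpenElts.val '' S)) = sSup (OpenElts.val '' _)
    rw [map_sSup, Set.image_image, Set.image_image])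

/-- The functor `𝒪 : MT ⥤ Frm` taking open elements. -/
def functorO : MT.{u} ⥤ Frm.{u} where
  obj M := Frm.of (OpenElts M)
  map f := Frm.ofHom f.hom'.onOpens

/-! ### The powerset functor -/

instance powersetMTAlgebra (X : Type u) [TopologicalSpace X] : MTAlgebra (Set X) where
  box := interior
  box_top := interior_univ
  box_inf _ _ := interior_inter
  box_le _ := interior_subset
  box_le_box_box _ := interior_interior.ge

/-- The functor `𝒫 : Topᵒᵖ ⥤ MT`, with `X ↦ (𝒫 X, int)` and `f ↦ f⁻¹`. -/
def functorP : TopCat.{u}ᵒᵖ ⥤ MT.{u} where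
  obj X := MT.of (Set X.unop)
  map f := ⟨{ toCompleteLatticeHom := CompleteLatticeHom.setPreimage f.unop
              map_box_le' := fun _ => preimage_interior_subset_interior_preimage
                f.unop.hom.continuous }⟩

/-! ### The space of atoms -/

/-- The atoms of `M`. -/
@[ext]
structure Atoms (M : Type u) [MTAlgebra M] : Type u where
  val : M
  property : IsAtom val

/-- The map `η : M → 𝒫 (at M)`. -/
def eta {M : Type u} [MTAlgebra M] (a : M) : Set (Atoms M) := {x | x.val ≤ a}

theorem atom_le_sSup {M : Type u} [MTAlgebra M] {x : M} (hx : IsAtom x) {S : Set M}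
    (h : x ≤ sSup S) : ∃ u ∈ S, x ≤ u := by
  by_contra hne
  push Not at hne
  have : x ≤ ⊥ := by
    have h2 : x = ⨆ b ∈ S, x ⊓ b := by rw [← inf_sSup_eq]; exact (inf_eq_left.2 h).symm
    rw [h2]
    refine iSup₂_le fun b hb => ?_
    exact (hx.le_iff.1 inf_le_left).elim le_of_eq
      fun he => absurd (inf_eq_left.1 he) (hne b hb)
  exact hx.1 (le_bot_iff.1 this)

/-- The topology `η[𝒪 M]` on the atoms of `M`. -/
instance (M : Type u) [MTAlgebra M] : TopologicalSpace (Atoms M) where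
  IsOpen U := ∃ a : M, IsOpenElt a ∧ eta a = U
  isOpen_univ := ⟨⊤, isOpenElt_top, Set.eq_univ_of_forall fun _ => (le_top : _ ≤ (⊤ : M))⟩
  isOpen_inter := by
    rintro _ _ ⟨a, ha, rfl⟩ ⟨b, hb, rfl⟩
    exact ⟨a ⊓ b, isOpenElt_inf ha hb, Set.ext fun x => le_inf_iff⟩
  isOpen_sUnion := by
    intro S hS
    refine ⟨sSup {a | IsOpenElt a ∧ eta a ∈ S}, isOpenElt_sSup fun u hu => hu.1,
      Set.ext fun x => ⟨fun hx => ?_, ?_⟩⟩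
    · obtain ⟨u, hu, hxu⟩ := atom_le_sSup x.property hx
      exact ⟨_, hu.2, hxu⟩
    · rintro ⟨U, hU, hxU⟩
      obtain ⟨a, ha, rfl⟩ := hS U hU
      exact le_trans (show x.1 ≤ a from hxU) (le_sSup ⟨ha, hU⟩)

/-- The left adjoint `f* y = ⋀ {a | y ≤ f a}` of an MT-morphism `f`. -/
def lowerAdjoint {M N : Type u} [MTAlgebra M] [MTAlgebra N] (f : MTHom M N) (y : N) : M :=
  sInf {a : M | y ≤ f a}

theorem lowerAdjoint_le_iff {M N : Type u} [MTAlgebra M] [MTAlgebra N] (f : MTHom M N) (y : N)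
    (a : M) : lowerAdjoint f y ≤ a ↔ y ≤ f a := by
  refine ⟨fun h => ?_, fun h => sInf_le h⟩
  refine le_trans ?_ (OrderHomClass.mono f h)
  rw [lowerAdjoint, map_sInf]
  refine le_sInf ?_
  rintro _ ⟨b, hb, rfl⟩
  exact hb

theorem isAtom_lowerAdjoint {M N : Type u} [MTAlgebra M] [MTAlgebra N] (f : MTHom M N) {y : N}
    (hy : IsAtom y) : IsAtom (lowerAdjoint f y) := by
  refine ⟨fun h => hy.1 ?_, fun z hz => ?_⟩
  · have := (lowerAdjoint_le_iff f y ⊥).1 h.le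
    rwa [map_bot, le_bot_iff] at this
  · by_cases h : y ≤ f z
    · exact absurd ((lowerAdjoint_le_iff f y z).2 h) hz.not_ge
    · have h1 : y ⊓ f z = ⊥ := (hy.le_iff.1 inf_le_left).resolve_right
        fun he => h (inf_eq_left.1 he)
      have h2 : y ≤ f zᶜ := by
        have hsup : f z ⊔ f zᶜ = ⊤ := by rw [← map_sup, sup_compl_eq_top, map_top]
        calc y = y ⊓ (f z ⊔ f zᶜ) := by rw [hsup, inf_top_eq]
          _ = y ⊓ f zᶜ := by rw [inf_sup_left, h1, bot_sup_eq]
          _ ≤ f zᶜ := inf_le_right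
      have h3 : z ≤ zᶜ := hz.le.trans ((lowerAdjoint_le_iff f y zᶜ).2 h2)
      have h4 : z ≤ z ⊓ zᶜ := le_inf le_rfl h3
      rwa [inf_compl_eq_bot, le_bot_iff] at h4

/-- The functor `at : MTᵒᵖ ⥤ Top`, sending `f` to the restriction of its left adjoint to
atoms. -/
def functorAt : MT.{u}ᵒᵖ ⥤ TopCat.{u} where
  obj M := TopCat.of (Atoms M.unop)
  map {M N} f := TopCat.ofHom
    { toFun := fun y => ⟨lowerAdjoint f.unop.hom' y.val, isAtom_lowerAdjoint _ y.property⟩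
      continuous_toFun := continuous_def.2 (by
        rintro _ ⟨a, ha, rfl⟩
        exact ⟨f.unop.hom' a, (f.unop.hom'.onOpens ⟨a, ha⟩).property,
          Set.ext fun y => (lowerAdjoint_le_iff f.unop.hom' y.val a).symm⟩) }
  map_id M := by
    ext y
    refine eq_of_forall_ge_iff fun a => ?_
    exact lowerAdjoint_le_iff (MTHom.id M.unop) y.val a
  map_comp {M N K} f g := by
    ext y
    refine eq_of_forall_ge_iff fun a => ?_
    exact (lowerAdjoint_le_iff (f.unop.hom'.comp g.unop.hom') y.val a).trans
      ((lowerAdjoint_le_iff g.unop.hom' _ a).trans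
        (lowerAdjoint_le_iff f.unop.hom' y.val _)).symm

/-! ### Points of a frame

A point of a frame `L` is a completely prime filter, encoded as in Mathlib by its characteristic
function, a frame homomorphism `L → Prop` (the type `Locale.PT L`, with its topology). -/

/-- The functor `pt : Frmᵒᵖ ⥤ Top`, with `pt h p = h⁻¹ p`. -/
def functorPt : Frm.{u}ᵒᵖ ⥤ TopCat.{u} where
  obj L := TopCat.of (Locale.PT L.unop)
  map h := TopCat.ofHom ⟨fun p => p.comp h.unop.hom, continuous_def.2 (by
    rintro _ ⟨a, rfl⟩
    exact ⟨h.unop a, rfl⟩)⟩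

/-- The functor `Ω : Topᵒᵖ ⥤ Frm`, with `Ω f U = f⁻¹ U`. -/
abbrev functorOmega : TopCat.{u}ᵒᵖ ⥤ Frm.{u} := topCatOpToFrm

/-- The composition `𝒫 ∘ pt : Frm ⥤ MT`. -/
abbrev functorPPt : Frm.{u} ⥤ MT.{u} := functorPt.rightOp ⋙ functorP

/-- The point `ϑ x = ↑x ∩ 𝒪 M` of `𝒪 M` defined by an atom `x` of `M`. -/
def theta {M : Type u} [MTAlgebra M] (x : Atoms M) : Locale.PT (OpenElts M) where
  toFun u := x.val ≤ u.val
  map_inf' a b := propext (le_inf_iff : x.val ≤ a.val ⊓ b.val ↔ _)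
  map_top' := propext ⟨fun _ => trivial, fun _ => (le_top : x.val ≤ (⊤ : M))⟩
  map_sSup' S := by
    refine propext ⟨fun h => ?_, ?_⟩
    · obtain ⟨_, ⟨u, hu, rfl⟩, hxu⟩ := atom_le_sSup x.property h
      exact ⟨_, ⟨u, hu, rfl⟩, hxu⟩
    · rintro ⟨_, ⟨u, hu, rfl⟩, hxu⟩
      exact le_trans hxu (le_sSup ⟨u, hu, rfl⟩)

/-- `ζ a = {p ∈ pt L | a ∈ p}`. -/
def zeta {L : Type u} [Order.Frame L] (a : L) : Set (Locale.PT L) := {p | p a}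

theorem isOpen_zeta {L : Type u} [Order.Frame L] (a : L) : IsOpen (zeta a) := ⟨a, rfl⟩

/-! ### Frames -/

section Frames

variable {L : Type u} [Order.Frame L]

/-- The way-below relation. -/
def WayBelow (a b : L) : Prop :=
  ∀ S : Set L, b ≤ sSup S → ∃ T ⊆ S, T.Finite ∧ a ≤ sSup T

variable (L)

/-- Continuous frames. -/
def IsContinuousFrame : Prop := ∀ a : L, a = sSup {x : L | WayBelow x a}

/-- Stability of the way-below relation. -/
def WayBelowStable : Prop := ∀ a b c : L, WayBelow a b → WayBelow a c → WayBelow a (b ⊓ c)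

/-- Compact frames. -/
def IsCompactFrame : Prop :=
  ∀ S : Set L, ⊤ = sSup S → ∃ T ⊆ S, T.Finite ∧ ⊤ = sSup T

end Frames

/-! ### Spaces -/

/-- Compact saturated subsets of a space (saturated: an intersection of open sets). -/
def IsCompactSaturated {X : Type u} [TopologicalSpace X] (K : Set X) : Prop :=
  IsCompact K ∧ ∃ S : Set (Set X), (∀ U ∈ S, IsOpen U) ∧ K = ⋂₀ S

/-- Proper continuous maps: preimages of compact saturated sets are compact (they are
automatically saturated). -/
def IsProperCont {X Y : Type u} [TopologicalSpace X] [TopologicalSpace Y] (f : X → Y) : Prop :=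
  ∀ K : Set Y, IsCompactSaturated K → IsCompact (f ⁻¹' K)

/-! ### The classes of objects and morphisms -/

/-- Locally compact sober MT-algebras. -/
def LCSobMT : ObjectProperty MT.{u} := fun M => IsLocallyCompact M ∧ IsSober M

/-- Stably locally compact MT-algebras. -/
def StLCMT : ObjectProperty MT.{u} := fun M =>
  LCSobMT M ∧ ∀ k m : M, IsKS k → IsKS m → IsKS (k ⊓ m)

/-- Stably compact MT-algebras. -/
def StKMT : ObjectProperty MT.{u} := fun M => StLCMT M ∧ IsCompactElt (⊤ : M)

/-- Spatial, i.e. atomic, MT-algebras. -/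
def SMT : ObjectProperty MT.{u} := fun M => IsAtomic M

/-- Proper MT-morphisms: those preserving compact saturated elements. -/
def properMT : MorphismProperty MT.{u} := fun M N f => ∀ a : M, IsKS a → IsKS (f.hom' a : N)

/-- Continuous frames. -/
def CFrm : ObjectProperty Frm.{u} := fun L => IsContinuousFrame L

/-- Stably continuous frames. -/
def StCFrm : ObjectProperty Frm.{u} := fun L => CFrm L ∧ WayBelowStable L

/-- Stably compact frames. -/
def StKFrm : ObjectProperty Frm.{u} := fun L => StCFrm L ∧ IsCompactFrame L

/-- Proper frame homomorphisms: those preserving the way-below relation. -/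
def properFrm : MorphismProperty Frm.{u} := fun L₁ L₂ f =>
  ∀ a b : L₁, WayBelow a b → WayBelow (f a : L₂) (f b)

/-- Locally compact sober spaces. -/
def LCSob : ObjectProperty TopCat.{u} := fun X =>
  LocallyCompactSpace X ∧ T0Space X ∧ QuasiSober X

/-- Stably locally compact spaces. -/
def StLCSob : ObjectProperty TopCat.{u} := fun X =>
  LCSob X ∧ ∀ K H : Set X, IsCompactSaturated K → IsCompactSaturated H → IsCompactSaturated (K ∩ H)

/-- Stably compact spaces. -/
def StKSob : ObjectProperty TopCat.{u} := fun X => StLCSob X ∧ CompactSpace X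

/-- Proper maps. -/
def properTop : MorphismProperty TopCat.{u} := fun _ _ f => IsProperCont f

instance : properMT.{u}.IsMultiplicative where
  id_mem _ _ ha := ha
  comp_mem _ _ hf hg a ha := hg _ (hf a ha)

instance : properFrm.{u}.IsMultiplicative where
  id_mem _ _ _ h := h
  comp_mem _ _ hf hg a b h := hg _ _ (hf a b h)

theorem IsProperCont.preimage {X Y : Type u} [TopologicalSpace X] [TopologicalSpace Y] {f : X → Y}
    (hf : IsProperCont f) (hc : Continuous f) {K : Set Y} (hK : IsCompactSaturated K) :
    IsCompactSaturated (f ⁻¹' K) := by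
  refine ⟨hf K hK, ?_⟩
  obtain ⟨_, S, hS, rfl⟩ := hK
  refine ⟨(fun U => f ⁻¹' U) '' S, ?_, ?_⟩
  · rintro _ ⟨U, hU, rfl⟩
    exact (hS U hU).preimage hc
  · rw [Set.preimage_sInter, Set.sInter_image]

instance : properTop.{u}.IsMultiplicative where
  id_mem _ _ hK := hK.1
  comp_mem _ _ hf hg _ hK := hf _ (IsProperCont.preimage hg (TopCat.Hom.hom _).continuous hK)

/-! ### Subcategories, and restrictions of functors to them -/

section Subcategories

universe v₁ v₂ u₁ u₂

variable {C : Type u₁} [Category.{v₁} C] {D : Type u₂} [Category.{v₂} D]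

/-- The subcategory of `C` with the objects in `P` and the morphisms between them in `W`. -/
@[ext]
structure Subcat (P : ObjectProperty C) (W : MorphismProperty C) where
  obj : C
  property : P obj

/-- Morphisms of `Subcat P W`. -/
@[ext]
structure Subcat.Hom {P : ObjectProperty C} {W : MorphismProperty C} (X Y : Subcat P W) where
  hom : X.obj ⟶ Y.obj
  property : W hom

instance (P : ObjectProperty C) (W : MorphismProperty C) [W.IsMultiplicative] :
    Category.{v₁} (Subcat P W) where
  Hom X Y := Subcat.Hom X Y
  id X := ⟨𝟙 X.obj, W.id_mem X.obj⟩
  comp f g := ⟨f.hom ≫ g.hom, W.comp_mem _ _ f.property g.property⟩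

/-- `F` maps the subcategory `(P, W)` into the subcategory `(Q, V)`. -/
structure Restricts (F : C ⥤ D) (P : ObjectProperty C) (W : MorphismProperty C)
    (Q : ObjectProperty D) (V : MorphismProperty D) : Prop where
  obj : ∀ X, P X → Q (F.obj X)
  map : ∀ {X Y : C} (f : X ⟶ Y), P X → P Y → W f → V (F.map f)

/-- The contravariant functor `F` maps the subcategory `(P, W)` into the subcategory `(Q, V)`. -/
structure RestrictsOp (F : Cᵒᵖ ⥤ D) (P : ObjectProperty C) (W : MorphismProperty C)
    (Q : ObjectProperty D) (V : MorphismProperty D) : Prop where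
  obj : ∀ X, P X → Q (F.obj (op X))
  map : ∀ {X Y : C} (f : X ⟶ Y), P X → P Y → W f → V (F.map f.op)

variable {P : ObjectProperty C} {W : MorphismProperty C} [W.IsMultiplicative]
  {Q : ObjectProperty D} {V : MorphismProperty D} [V.IsMultiplicative]

/-- The restriction of a functor. -/
def Restricts.functor {F : C ⥤ D} (h : Restricts F P W Q V) : Subcat P W ⥤ Subcat Q V where
  obj X := ⟨F.obj X.obj, h.obj _ X.property⟩
  map {X Y} f := ⟨F.map f.hom, h.map _ X.property Y.property f.property⟩
  map_id X := Subcat.Hom.ext (F.map_id X.obj)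
  map_comp f g := Subcat.Hom.ext (F.map_comp f.hom g.hom)

/-- The restriction of a contravariant functor. -/
def RestrictsOp.functor {F : Cᵒᵖ ⥤ D} (h : RestrictsOp F P W Q V) :
    (Subcat P W)ᵒᵖ ⥤ Subcat Q V where
  obj X := ⟨F.obj (op X.unop.obj), h.obj _ X.unop.property⟩
  map {X Y} f := ⟨F.map f.unop.hom.op, h.map _ Y.unop.property X.unop.property f.unop.property⟩
  map_id X := Subcat.Hom.ext (F.map_id (op X.unop.obj))
  map_comp f g := Subcat.Hom.ext (F.map_comp f.unop.hom.op g.unop.hom.op)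

end Subcategories

/-! ### The adjunctions

In each of the following, `A`, `B`, `S` are classes of MT-algebras, frames and spaces, regarded as
full subcategories of the categories with the proper morphisms. The functors are always the
restrictions of the same functors `𝒪`, `𝒫`, `at`, `pt`, `Ω`, and the units and counits are given by
the same formulas whatever the classes are. So when `A' ≤ A` and `B' ≤ B`, an adjunction of the
type below for `A'` and `B'` is the restriction of the one for `A` and `B`. -/

/-- `𝒪` and `𝒫 ∘ pt` restrict to functors between `A` and `B`, and `adj` is an adjunction between
these with `𝒪` on the left, whose unit is `(𝒫ϑ) ∘ η`, that is `a ↦ {ϑ x | x ∈ η a}`,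
and whose counit is `ζ⁻¹`. -/
structure OPtAdjunction (A : ObjectProperty MT.{u}) (B : ObjectProperty Frm.{u}) where
  restrictsO : Restricts functorO.{u} A properMT B properFrm
  restrictsPPt : Restricts functorPPt.{u} B properFrm A properMT
  adj : restrictsO.functor ⊣ restrictsPPt.functor
  unit_apply : ∀ (M : Subcat A properMT.{u}) (a : M.obj),
    (adj.unit.app M).hom.hom' a = (theta '' eta a : Set (Locale.PT (OpenElts M.obj)))
  counit_apply : ∀ (L : Subcat B properFrm.{u}) (a : L.obj),
    (adj.counit.app L).hom (⟨zeta a, (isOpen_zeta a).interior_eq.symm⟩ :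
      OpenElts (Set (Locale.PT L.obj))) = a

/-- `at` and `𝒫` restrict to contravariant functors between `A` and `S`, and `adj` is a dual
adjunction between these, with units `η a = {x | x ≤ a}` and `ε x = {x}`. -/
structure AtPDualAdjunction (A : ObjectProperty MT.{u}) (S : ObjectProperty TopCat.{u}) where
  restrictsAt : RestrictsOp functorAt.{u} A properMT S properTop
  restrictsP : RestrictsOp functorP.{u} S properTop A properMT
  adj : restrictsAt.functor.rightOp ⊣ restrictsP.functor
  unit_apply : ∀ (M : Subcat A properMT.{u}) (a : M.obj),
    (adj.unit.app M).hom.hom' a = (eta a : Set (Atoms M.obj))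
  counit_apply : ∀ (X : Subcat S properTop.{u}) (x : X.obj),
    (adj.counit.app (op X)).unop.hom x = (⟨{x}, Set.isAtom_singleton x⟩ : Atoms (Set X.obj))

/-- `pt` and `Ω` restrict to contravariant functors between `B` and `S`, and `adj` is a dual
adjunction between these, with units `ζ` and `δ x = {U | x ∈ U}`. -/
structure PtOmegaDualAdjunction (B : ObjectProperty Frm.{u}) (S : ObjectProperty TopCat.{u}) where
  restrictsPt : RestrictsOp functorPt.{u} B properFrm S properTop
  restrictsOmega : RestrictsOp functorOmega.{u} S properTop B properFrm
  adj : restrictsPt.functor.rightOp ⊣ restrictsOmega.functor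
  unit_apply : ∀ (L : Subcat B properFrm.{u}) (a : L.obj),
    (adj.unit.app L).hom a = (⟨zeta a, isOpen_zeta a⟩ : TopologicalSpace.Opens (Locale.PT L.obj))
  counit_apply : ∀ (X : Subcat S properTop.{u}) (x : X.obj),
    (adj.counit.app (op X)).unop.hom x = Locale.localePointOfSpacePoint X.obj x

/-- An adjunction is an equivalence (with the given unit and counit) if its unit and counit are
natural isomorphisms. -/
def IsEquivalenceAdj {C : Type*} {D : Type*} [Category C] [Category D] {F : C ⥤ D} {G : D ⥤ C}
    (adj : F ⊣ G) : Prop := IsIso adj.unit ∧ IsIso adj.counit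

end MTDuality

open MTDuality

namespace MTDuality

/-! ### Open and compact elements of a powerset -/

section Powerset

variable {X : Type u} [TopologicalSpace X]

/-! The engine is the Hofmann–Mislove correspondence. A Scott-open filter `F` of a frame is
determined by the points containing it (`IsScottOpenFilter.pointsAbove_subset_iff`). Hence
`pointsAbove F` is compact saturated, and every compact saturated set of points arises in this way
from its filter of open neighbourhoods. In a continuous frame, `b ≪ a` leaves room for a Scott-open
filter containing `a` and bounded below by `b`. This makes the frame spatial and its space of points
locally compact. Stability of `≪`, compactness of the frame and properness of a homomorphism each
translate into the Scott-openness of a suitable filter.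

On the algebraic side, sobriety makes `ϑ` a homeomorphism from the atoms of `M` to the points of `𝒪
M`, so that `at` agrees with `pt ∘ 𝒪`. Local compactness makes `a ≪ b` in `𝒪 M` equivalent to the
existence of a compact saturated `k` with `a ≤ k ≤ b`. So `𝒪 M` is continuous, and proper morphisms
preserve `≪`. Even without spatiality, atoms decide whether a compact saturated element lies below
an open one (`IsKS.le_of_eta_subset`), so `η` is proper. Spatiality is what turns `η` into an
isomorphism.

The unit and counit formulas do not depend on the classes of objects. The adjunctions are therefore
built once for arbitrary classes that the functors exchange, and the three levels of the theorem
differ only in preservation of objects. -/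

theorem isOpenElt_iff_isOpen {U : Set X} : IsOpenElt U ↔ IsOpen U :=
  eq_comm.trans interior_eq_iff_isOpen

theorem isCompact_iff_isCompactElt {K : Set X} : IsCompact K ↔ IsCompactElt K := by
  constructor
  · intro hK S hS hKS
    obtain ⟨T, hT, hTf, hKT⟩ := hK.elim_finite_subcover_image (b := S) (c := id)
      (fun U hU => isOpenElt_iff_isOpen.1 (hS U hU)) (Set.sUnion_eq_biUnion ▸ hKS)
    exact ⟨T, hT, hTf, hKT.trans (Set.sUnion_eq_biUnion (s := T)).superset⟩
  · intro hK
    -- Alexander's subbase theorem, with all open sets as the subbase, passes from covers to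
    -- compactness.
    refine isCompact_generateFrom (S := {U | IsOpen U})
      (TopologicalSpace.generateFrom_setOfPred_isOpen _).symm fun P hP hKP => ?_
    exact hK P (fun U hU => isOpenElt_iff_isOpen.2 (hP hU)) hKP

theorem isKS_iff_isCompactSaturated {K : Set X} : IsKS K ↔ IsCompactSaturated K := by
  simp only [IsKS, IsCompactSaturated, isCompact_iff_isCompactElt, IsSaturatedElt,
    isOpenElt_iff_isOpen]
  rfl

end Powerset

/-! ### Scott-open filters of a frame and the Hofmann–Mislove theorem -/

section ScottOpen

variable {L : Type u} [Order.Frame L]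

/-- Scott-open filters of a frame. -/
structure IsScottOpenFilter (F : Set L) : Prop where
  top_mem : ⊤ ∈ F
  mem_of_le : ∀ {a b : L}, a ∈ F → a ≤ b → b ∈ F
  inf_mem : ∀ {a b : L}, a ∈ F → b ∈ F → a ⊓ b ∈ F
  exists_finite : ∀ S : Set L, sSup S ∈ F → ∃ T ⊆ S, T.Finite ∧ sSup T ∈ F

/-- The point `{a | ¬ a ≤ v}` defined by a prime element `v` of a frame. -/
def pointOfInfPrime {v : L} (hv : InfPrime v) : Locale.PT L where
  toFun a := ¬ a ≤ v
  map_inf' a b := propext (by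
    change ¬ (a ⊓ b ≤ v) ↔ (¬ a ≤ v ∧ ¬ b ≤ v)
    rw [hv.inf_le, not_or])
  map_top' := propext ⟨fun _ => trivial, fun _ h => hv.1 (fun _ _ => le_top.trans h)⟩
  map_sSup' S := propext (by
    rw [sSup_le_iff, sSup_Prop_eq]
    push Not
    constructor
    · rintro ⟨a, ha, h⟩
      exact ⟨_, ⟨a, ha, rfl⟩, h⟩
    · rintro ⟨_, ⟨a, ha, rfl⟩, h⟩
      exact ⟨a, ha, h⟩)

/-- In a chain, the join of a finite set is its greatest element. -/
theorem sSup_mem_of_finite_chain {C T : Set L} (hC : IsChain (· ≤ ·) C) (hT : T.Finite)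
    (hTC : T ⊆ C) (hne : T.Nonempty) : sSup T ∈ C := by
  obtain ⟨m, hm, hmax⟩ := hT.exists_maximal hne
  have : sSup T = m := le_antisymm
    (sSup_le fun t ht => (hC.total (hTC ht) (hTC hm)).elim id fun h => hmax ht h) (le_sSup hm)
  rw [this]
  exact hTC hm

/-- Scott-openness keeps the complement of `F` closed under joins of nonempty chains, so Zorn's
lemma gives a `v ≥ c` maximal outside `F`. Maximality, distributivity and closure of `F` under meets
make `v` prime. -/
theorem IsScottOpenFilter.exists_infPrime {F : Set L} (hF : IsScottOpenFilter F) {c : L}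
    (hc : c ∉ F) : ∃ v, InfPrime v ∧ c ≤ v ∧ v ∉ F := by
  obtain ⟨v, hcv, hv⟩ := zorn_le_nonempty₀ {v : L | v ∉ F} (fun C hC hchain y hy => by
    refine ⟨sSup C, fun hmem => ?_, fun z hz => le_sSup hz⟩
    obtain ⟨T, hTC, hTf, hT⟩ := hF.exists_finite C hmem
    -- An empty `T` would put `⊥` in `F`, hence also the member `y` of the chain.
    rcases T.eq_empty_or_nonempty with rfl | hne
    · rw [sSup_empty] at hT
      exact hC hy (hF.mem_of_le hT bot_le)
    · exact hC (sSup_mem_of_finite_chain hchain hTf hTC hne) hT) c hc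
  have hmax : ∀ a : L, ¬ a ≤ v → v ⊔ a ∈ F := fun a ha => by
    by_contra hn
    exact ha (le_sup_right.trans (hv.2 hn le_sup_left))
  refine ⟨v, ⟨fun h => hv.1 ?_, fun a b hab => ?_⟩, hcv, hv.1⟩
  · exact hF.mem_of_le hF.top_mem (h le_top)
  · by_contra hn
    rw [not_or] at hn
    have := hF.inf_mem (hmax a hn.1) (hmax b hn.2)
    rw [← sup_inf_left, sup_eq_left.2 hab] at this
    exact hv.1 this

/-- **Hofmann–Mislove**: a Scott-open filter is the intersection of the completely prime filters
containing it. -/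
theorem IsScottOpenFilter.exists_point {F : Set L} (hF : IsScottOpenFilter F) {c : L}
    (hc : c ∉ F) : ∃ p : Locale.PT L, (∀ a ∈ F, p a) ∧ ¬ p c := by
  obtain ⟨v, hv, hcv, hvF⟩ := hF.exists_infPrime hc
  exact ⟨pointOfInfPrime hv, fun a ha hav => hvF (hF.mem_of_le ha hav), fun h => h hcv⟩

/-- The set of points containing a given set of elements. -/
def pointsAbove (F : Set L) : Set (Locale.PT L) := {p | ∀ a ∈ F, p a}

theorem point_mono (p : Locale.PT L) {a b : L} (h : a ≤ b) (ha : p a) : p b :=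
  OrderHomClass.mono p h ha

theorem zeta_mono {a b : L} (h : a ≤ b) : zeta a ⊆ zeta b := fun p ha => point_mono p h ha

theorem point_inf (p : Locale.PT L) (a b : L) : p (a ⊓ b) ↔ p a ∧ p b := iff_of_eq (map_inf p a b)

theorem point_top (p : Locale.PT L) : p ⊤ := (iff_of_eq (map_top p)).2 trivial

theorem zeta_inf (a b : L) : zeta (a ⊓ b) = zeta a ∩ zeta b :=
  Set.ext fun p => point_inf p a b

theorem zeta_top : zeta (⊤ : L) = Set.univ :=
  Set.eq_univ_of_forall point_top

theorem point_sSup (p : Locale.PT L) (S : Set L) : p (sSup S) ↔ ∃ a ∈ S, p a := by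
  rw [map_sSup, sSup_Prop_eq]
  constructor
  · rintro ⟨_, ⟨a, ha, rfl⟩, h⟩
    exact ⟨a, ha, h⟩
  · rintro ⟨a, ha, h⟩
    exact ⟨_, ⟨a, ha, rfl⟩, h⟩

theorem zeta_sSup (S : Set L) : zeta (sSup S) = ⋃ a ∈ S, zeta a := by
  ext p
  simp only [Set.mem_iUnion, exists_prop]
  exact point_sSup p S

theorem exists_zeta_eq {U : Set (Locale.PT L)} (hU : IsOpen U) : ∃ a : L, zeta a = U := hU

theorem IsScottOpenFilter.pointsAbove_subset_iff {F : Set L} (hF : IsScottOpenFilter F) {c : L} :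
    pointsAbove F ⊆ zeta c ↔ c ∈ F := by
  refine ⟨fun h => ?_, fun h p hp => hp c h⟩
  by_contra hc
  obtain ⟨p, hp, hpc⟩ := hF.exists_point hc
  exact hpc (h hp)

theorem isSaturated_pointsAbove (F : Set L) :
    ∃ S : Set (Set (Locale.PT L)), (∀ U ∈ S, IsOpen U) ∧ pointsAbove F = ⋂₀ S := by
  refine ⟨zeta '' F, ?_, ?_⟩
  · rintro _ ⟨a, _, rfl⟩
    exact isOpen_zeta a
  · rw [Set.sInter_image]
    ext p
    simp [pointsAbove, zeta]

/-- A cover by sets `ζ a` has the join of the `a` in `F`, by Hofmann–Mislove; Scott-openness then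
picks finitely many of them. -/
theorem IsScottOpenFilter.isCompactSaturated {F : Set L} (hF : IsScottOpenFilter F) :
    IsCompactSaturated (pointsAbove F) := by
  refine ⟨isCompact_iff_isCompactElt.2 fun S hS hcov => ?_, isSaturated_pointsAbove F⟩
  have h1 : pointsAbove F ⊆ zeta (sSup {a : L | zeta a ∈ S}) := by
    rw [zeta_sSup]
    intro p hp
    obtain ⟨U, hU, hpU⟩ := hcov hp
    obtain ⟨a, rfl⟩ := exists_zeta_eq (isOpenElt_iff_isOpen.1 (hS U hU))
    exact Set.mem_biUnion hU hpU
  obtain ⟨T, hT, hTf, hTF⟩ := hF.exists_finite _ (hF.pointsAbove_subset_iff.1 h1)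
  refine ⟨zeta '' T, Set.image_subset_iff.2 hT, hTf.image _, ?_⟩
  have := hF.pointsAbove_subset_iff.2 hTF
  rwa [zeta_sSup, ← Set.sUnion_image] at this

/-- The Scott-open filter of the open neighbourhoods of a compact set of points. -/
def nhdsFilter (K : Set (Locale.PT L)) : Set L := {a | K ⊆ zeta a}

theorem isScottOpenFilter_nhdsFilter {K : Set (Locale.PT L)} (hK : IsCompact K) :
    IsScottOpenFilter (nhdsFilter K) where
  top_mem := by simp [nhdsFilter, zeta_top]
  mem_of_le ha h := Set.Subset.trans ha (zeta_mono h)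
  inf_mem {a b} ha hb := by
    change K ⊆ _
    rw [zeta_inf]
    exact Set.subset_inter ha hb
  exists_finite S hS := by
    change K ⊆ _ at hS
    rw [zeta_sSup] at hS
    obtain ⟨T, hT, hTf, hKT⟩ := hK.elim_finite_subcover_image (fun a _ => isOpen_zeta a) hS
    refine ⟨T, hT, hTf, ?_⟩
    change K ⊆ _
    rwa [zeta_sSup]

/-- The other half of the correspondence: a saturated set is recovered from its open neighbourhoods.
-/
theorem pointsAbove_nhdsFilter {K : Set (Locale.PT L)}
    (hK : ∃ S : Set (Set (Locale.PT L)), (∀ U ∈ S, IsOpen U) ∧ K = ⋂₀ S) :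
    pointsAbove (nhdsFilter K) = K := by
  obtain ⟨S, hS, hKS⟩ := hK
  refine Set.Subset.antisymm (fun p hp => ?_) fun p hp a ha => ha hp
  rw [hKS]
  intro U hU
  obtain ⟨a, rfl⟩ := exists_zeta_eq (hS U hU)
  exact hp a (hKS.subset.trans (Set.sInter_subset_of_mem hU))

end ScottOpen

/-! ### The way-below relation -/

section WayBelow

variable {L : Type u} [Order.Frame L]

theorem WayBelow.le {a b : L} (h : WayBelow a b) : a ≤ b := by
  obtain ⟨T, hT, _, haT⟩ := h {b} (by simp)
  exact haT.trans (sSup_le fun t ht => (hT ht).le)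

theorem WayBelow.mono {a b c d : L} (h : WayBelow b c) (hab : a ≤ b) (hcd : c ≤ d) :
    WayBelow a d := fun S hS => by
  obtain ⟨T, hT, hTf, hbT⟩ := h S (hcd.trans hS)
  exact ⟨T, hT, hTf, hab.trans hbT⟩

theorem wayBelow_bot (a : L) : WayBelow ⊥ a := fun _ _ =>
  ⟨∅, Set.empty_subset _, Set.finite_empty, bot_le⟩

theorem WayBelow.sup {a b c : L} (ha : WayBelow a c) (hb : WayBelow b c) : WayBelow (a ⊔ b) c :=
  fun S hS => by
    obtain ⟨T, hT, hTf, haT⟩ := ha S hS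
    obtain ⟨T', hT', hTf', hbT⟩ := hb S hS
    exact ⟨T ∪ T', Set.union_subset hT hT', hTf.union hTf', by
      rw [sSup_union]; exact sup_le_sup haT hbT⟩

theorem wayBelow_sSup_of_finite {T : Set L} (hT : T.Finite) {c : L} (h : ∀ a ∈ T, WayBelow a c) :
    WayBelow (sSup T) c := by
  induction T, hT using Set.Finite.induction_on with
  | empty => simpa using wayBelow_bot c
  | @insert a s _ _ ih =>
    rw [sSup_insert]
    exact (h a (Set.mem_insert a s)).sup (ih fun b hb => h b (Set.mem_insert_of_mem a hb))

/-- Applying continuity twice writes `b` as the join of the `y` with `y ≪ x ≪ b` for some `x`.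
Finitely many `y` cover `a`, and the join of their chosen `x` interpolates. -/
theorem IsContinuousFrame.interpolate (hL : IsContinuousFrame L) {a b : L} (h : WayBelow a b) :
    ∃ c, WayBelow a c ∧ WayBelow c b := by
  have hb : b ≤ sSup {y : L | ∃ x, WayBelow y x ∧ WayBelow x b} := by
    conv_lhs => rw [hL b]
    refine sSup_le fun x hx => ?_
    conv_lhs => rw [hL x]
    exact sSup_le fun y hy => le_sSup ⟨x, hy, hx⟩
  obtain ⟨T, hT, hTf, haT⟩ := h _ hb
  choose! x hx using hT
  refine ⟨sSup (x '' T), (wayBelow_sSup_of_finite hTf fun y hy => ?_).mono haT le_rfl,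
    wayBelow_sSup_of_finite (hTf.image x) ?_⟩
  · exact (hx hy).1.mono le_rfl (le_sSup ⟨y, hy, rfl⟩)
  · rintro _ ⟨y, hy, rfl⟩
    exact (hx hy).2

/-- Between `b ≪ a` there is a Scott-open filter. -/
theorem IsContinuousFrame.exists_scottOpenFilter (hL : IsContinuousFrame L) {a b : L}
    (h : WayBelow b a) : ∃ F : Set L, IsScottOpenFilter F ∧ a ∈ F ∧ ∀ c ∈ F, b ≤ c := by
  choose g hg1 hg2 using fun x : {x : L // WayBelow b x} => hL.interpolate x.2
  -- Iterated interpolation gives a chain `a = s 0 ≫ s 1 ≫ ⋯`, all of it way above `b`; the filter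
  -- is its upward closure.
  let s : ℕ → {x : L // WayBelow b x} := fun n =>
    Nat.rec ⟨a, h⟩ (fun _ x => ⟨g x, hg1 x⟩) n
  have hs : ∀ n, WayBelow (s (n + 1)).1 (s n).1 := fun n => hg2 (s n)
  have hanti : Antitone fun n => (s n).1 := antitone_nat_of_succ_le fun n => (hs n).le
  refine ⟨{c | ∃ n, (s n).1 ≤ c}, ⟨⟨0, le_top⟩, ?_, ?_, ?_⟩, ⟨0, le_rfl⟩, ?_⟩
  · rintro c d ⟨n, hn⟩ hcd
    exact ⟨n, hn.trans hcd⟩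
  · rintro c d ⟨n, hn⟩ ⟨m, hm⟩
    exact ⟨max n m, le_inf ((hanti (le_max_left n m)).trans hn)
      ((hanti (le_max_right n m)).trans hm)⟩
  · rintro S ⟨n, hn⟩
    -- A join above `s n` has a finite subjoin above `s (n + 1)`, which is why the index moves by
    -- one.
    obtain ⟨T, hT, hTf, hnT⟩ := hs n S hn
    exact ⟨T, hT, hTf, n + 1, hnT⟩
  · rintro c ⟨n, hn⟩
    exact (s n).2.le.trans hn

/-- Scott-open filters are rounded: `a` is the join of the elements way below it, and a finite
subjoin already lies in `F` and is still way below `a`. -/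
theorem IsScottOpenFilter.exists_wayBelow (hL : IsContinuousFrame L) {F : Set L}
    (hF : IsScottOpenFilter F) {a : L} (ha : a ∈ F) : ∃ b ∈ F, WayBelow b a := by
  rw [hL a] at ha
  obtain ⟨T, hT, hTf, hTF⟩ := hF.exists_finite _ ha
  exact ⟨_, hTF, wayBelow_sSup_of_finite hTf hT⟩

/-- Continuous frames are spatial. -/
theorem IsContinuousFrame.le_of_zeta_subset (hL : IsContinuousFrame L) {a b : L}
    (h : zeta a ⊆ zeta b) : a ≤ b := by
  rw [hL a]
  refine sSup_le fun x hx => ?_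
  obtain ⟨F, hF, haF, hxF⟩ := hL.exists_scottOpenFilter hx
  refine hxF b (hF.pointsAbove_subset_iff.1 ?_)
  exact (hF.pointsAbove_subset_iff.2 haF).trans h

theorem IsContinuousFrame.zeta_injective (hL : IsContinuousFrame L) :
    Function.Injective (zeta : L → Set (Locale.PT L)) := fun _ _ h =>
  le_antisymm (hL.le_of_zeta_subset h.subset) (hL.le_of_zeta_subset h.superset)

end WayBelow

/-! ### The space of points of a continuous frame -/

section Points

variable (L : Type u) [Order.Frame L]

theorem t0Space_points : T0Space (Locale.PT L) := by
  refine ⟨fun p q h => ?_⟩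
  refine DFunLike.ext p q fun a => propext ?_
  exact (inseparable_iff_forall_isOpen.1 h) (zeta a) (isOpen_zeta a)

/-- For an irreducible closed `Z`, the largest `a` with `ζ a` disjoint from `Z` is prime, and the
point it defines is generic in `Z`. -/
theorem quasiSober_points : QuasiSober (Locale.PT L) := by
  refine ⟨fun {Z} hZ hcl => ?_⟩
  have hmeet : ∀ a : L, a ≤ sSup {a | zeta a ⊆ Zᶜ} ↔ zeta a ⊆ Zᶜ := fun a => by
    refine ⟨fun h => (zeta_mono h).trans ?_, fun h => le_sSup h⟩
    rw [zeta_sSup]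
    exact Set.iUnion₂_subset fun b hb => hb
  have hnot : ∀ a : L, ¬ zeta a ⊆ Zᶜ ↔ (Z ∩ zeta a).Nonempty := fun a => by
    rw [← Set.not_disjoint_iff_nonempty_inter, Set.subset_compl_iff_disjoint_left]
  have hprime : InfPrime (sSup {a : L | zeta a ⊆ Zᶜ}) := by
    refine ⟨fun hmax => ?_, fun a b hab => ?_⟩
    · have := (hmeet ⊤).1 (hmax le_top)
      rw [zeta_top] at this
      obtain ⟨z, hz⟩ := hZ.1
      exact this trivial hz
    · rw [hmeet, hmeet]
      by_contra hn
      rw [not_or, hnot, hnot] at hn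
      have := hZ.2 _ _ (isOpen_zeta a) (isOpen_zeta b) hn.1 hn.2
      rw [← zeta_inf, ← hnot, ← hmeet] at this
      exact this hab
  refine ⟨pointOfInfPrime hprime, ?_⟩
  have hmem : ∀ a : L, pointOfInfPrime hprime ∈ zeta a ↔ (Z ∩ zeta a).Nonempty := fun a => by
    rw [← hnot, ← hmeet]
    rfl
  have key : ∀ W : Set (Locale.PT L), IsClosed W → (pointOfInfPrime hprime ∈ W ↔ Z ⊆ W) :=
      fun W hW => by
    obtain ⟨a, ha⟩ := exists_zeta_eq hW.isOpen_compl
    have := hmem a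
    rw [ha, Set.inter_compl_nonempty_iff, Set.mem_compl_iff, not_iff_not] at this
    exact this
  rw [isGenericPoint_iff_forall_closed hcl ((key Z hcl).2 subset_rfl)]
  exact fun W hW => (key W hW).1

variable {L}

/-- If `p ∈ ζ a`, then `p ∈ ζ b` for some `b ≪ a`. A Scott-open filter between the two gives a
compact set between `ζ b` and `ζ a`. -/
theorem IsContinuousFrame.locallyCompactSpace (hL : IsContinuousFrame L) :
    LocallyCompactSpace (Locale.PT L) := by
  refine ⟨fun p N hN => ?_⟩
  obtain ⟨U, hUN, hU, hpU⟩ := mem_nhds_iff.1 hN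
  obtain ⟨a, rfl⟩ := exists_zeta_eq hU
  have hpa : p a := hpU
  rw [hL a, point_sSup] at hpa
  obtain ⟨b, hba, hpb⟩ := hpa
  obtain ⟨F, hF, haF, hbF⟩ := hL.exists_scottOpenFilter hba
  refine ⟨pointsAbove F, mem_nhds_iff.2 ⟨zeta b, fun q hq c hc => ?_, isOpen_zeta b, hpb⟩,
    (hF.pointsAbove_subset_iff.2 haF).trans hUN, hF.isCompactSaturated.1⟩
  exact point_mono q (hbF c hc) hq

theorem LCSob_points (hL : IsContinuousFrame L) : LCSob (TopCat.of (Locale.PT L)) :=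
  ⟨hL.locallyCompactSpace, t0Space_points L, quasiSober_points L⟩

/-- By roundness `a` and `b` may be shrunk inside their filters to `a' ≪ a` and `b' ≪ b`; stability
then yields `a' ⊓ b' ≪ a ⊓ b`. The points above this generated filter are those above both `F` and
`G`, so it handles intersections of compact saturated sets. -/
theorem WayBelowStable.isScottOpenFilter (hL : IsContinuousFrame L) (hst : WayBelowStable L)
    {F G : Set L} (hF : IsScottOpenFilter F) (hG : IsScottOpenFilter G) :
    IsScottOpenFilter {c : L | ∃ a ∈ F, ∃ b ∈ G, a ⊓ b ≤ c} where
  top_mem := ⟨⊤, hF.top_mem, ⊤, hG.top_mem, le_top⟩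
  mem_of_le := by
    rintro c d ⟨a, ha, b, hb, h⟩ hcd
    exact ⟨a, ha, b, hb, h.trans hcd⟩
  inf_mem := by
    rintro c d ⟨a, ha, b, hb, h⟩ ⟨a', ha', b', hb', h'⟩
    refine ⟨a ⊓ a', hF.inf_mem ha ha', b ⊓ b', hG.inf_mem hb hb', ?_⟩
    rw [inf_inf_inf_comm]
    exact inf_le_inf h h'
  exists_finite := by
    rintro S ⟨a, ha, b, hb, h⟩
    obtain ⟨a', ha', haa⟩ := hF.exists_wayBelow hL ha
    obtain ⟨b', hb', hbb⟩ := hG.exists_wayBelow hL hb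
    obtain ⟨T, hT, hTf, hle⟩ := hst (a' ⊓ b') a b (haa.mono inf_le_left le_rfl)
      (hbb.mono inf_le_right le_rfl) S h
    exact ⟨T, hT, hTf, a', ha', b', hb', hle⟩

theorem StLCSob_points (hL : IsContinuousFrame L) (hst : WayBelowStable L) :
    StLCSob (TopCat.of (Locale.PT L)) := by
  refine ⟨LCSob_points hL, fun K H (hK : IsCompactSaturated (X := Locale.PT L) K)
    (hH : IsCompactSaturated (X := Locale.PT L) H) => ?_⟩
  have := (hst.isScottOpenFilter hL (isScottOpenFilter_nhdsFilter hK.1)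
    (isScottOpenFilter_nhdsFilter hH.1)).isCompactSaturated
  convert this using 1
  refine Set.Subset.antisymm ?_ ?_
  · rintro p ⟨hpK, hpH⟩ c ⟨a, ha, b, hb, h⟩
    exact zeta_mono h ((zeta_inf a b).superset ⟨ha hpK, hb hpH⟩)
  · intro p hp
    refine ⟨?_, ?_⟩
    · rw [← pointsAbove_nhdsFilter hK.2]
      -- Taking `⊤` from the other filter shows that the generated filter contains each of the two.
      exact fun a ha => hp a ⟨a, ha, ⊤, by simp [nhdsFilter, zeta_top], inf_le_left⟩
    · rw [← pointsAbove_nhdsFilter hH.2]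
      exact fun a ha => hp a ⟨⊤, by simp [nhdsFilter, zeta_top], a, ha, inf_le_right⟩

/-- Compactness of the frame makes `{⊤}` a Scott-open filter, and every point contains `⊤`. -/
theorem IsCompactFrame.compactSpace (hL : IsCompactFrame L) : CompactSpace (Locale.PT L) := by
  have hF : IsScottOpenFilter ({⊤} : Set L) :=
    { top_mem := rfl
      mem_of_le := fun ha h => top_le_iff.1 (ha ▸ h)
      inf_mem := by rintro a b rfl rfl; simp
      exists_finite := fun S hS => by
        obtain ⟨T, hT, hTf, h⟩ := hL S hS.symm
        exact ⟨T, hT, hTf, h.symm⟩ }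
  have huniv : pointsAbove ({⊤} : Set L) = Set.univ :=
    Set.univ_subset_iff.1 fun p _ a ha => (by rw [ha]; exact zeta_top.superset trivial : p ∈ zeta a)
  exact ⟨huniv ▸ hF.isCompactSaturated.1⟩

/-- The preimage of `K` is the set of points above the filter generated by the image under `h` of
the neighbourhood filter of `K`. Roundness of the latter and preservation of `≪` make this image
filter Scott-open. -/
theorem isProperCont_comp {L' : Type u} [Order.Frame L'] (hL : IsContinuousFrame L)
    (h : FrameHom L L') (hh : ∀ a b : L, WayBelow a b → WayBelow (h a) (h b)) :
    IsProperCont fun p : Locale.PT L' => (p.comp h : Locale.PT L) := by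
  intro K hK
  have hF := isScottOpenFilter_nhdsFilter hK.1
  have hG : IsScottOpenFilter {b : L' | ∃ a ∈ nhdsFilter K, h a ≤ b} :=
    { top_mem := ⟨⊤, hF.top_mem, le_top⟩
      mem_of_le := by
        rintro b c ⟨a, ha, hab⟩ hbc
        exact ⟨a, ha, hab.trans hbc⟩
      inf_mem := by
        rintro b c ⟨a, ha, hab⟩ ⟨a', ha', hac⟩
        exact ⟨a ⊓ a', hF.inf_mem ha ha', by rw [map_inf]; exact inf_le_inf hab hac⟩
      exists_finite := by
        rintro S ⟨a, ha, haS⟩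
        obtain ⟨a', ha', haa⟩ := hF.exists_wayBelow hL ha
        obtain ⟨T, hT, hTf, hle⟩ := hh _ _ haa S haS
        exact ⟨T, hT, hTf, a', ha', hle⟩ }
  convert hG.isCompactSaturated.1 using 1
  refine Set.Subset.antisymm ?_ ?_
  · rintro p hp b ⟨a, ha, hab⟩
    exact point_mono p hab (ha hp)
  · intro p hp
    change p.comp h ∈ K
    rw [← pointsAbove_nhdsFilter hK.2]
    exact fun a ha => hp (h a) ⟨a, ha, le_rfl⟩

end Points

/-! ### Atoms of an MT-algebra and points of its frame of opens -/

section Atoms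

variable {M : Type u} [MTAlgebra M]

theorem atom_le_compl_iff {x : M} (hx : IsAtom x) {a : M} : x ≤ aᶜ ↔ ¬ x ≤ a := by
  rw [le_compl_iff_disjoint_right, hx.not_le_iff_disjoint]

theorem isClosedElt_iff {c : M} : IsClosedElt c ↔ IsOpenElt cᶜ := by
  unfold IsClosedElt IsOpenElt diamond
  rw [eq_compl_comm, eq_comm]

theorem atom_le_sSup_iff {x : M} (hx : IsAtom x) {S : Set M} : x ≤ sSup S ↔ ∃ u ∈ S, x ≤ u :=
  ⟨atom_le_sSup hx, fun ⟨_, hu, h⟩ => h.trans (le_sSup hu)⟩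

theorem eta_mono {a b : M} (h : a ≤ b) : eta a ⊆ eta b := fun _ hx => le_trans hx h

theorem isOpen_eta {a : M} (ha : IsOpenElt a) : IsOpen (eta a) := ⟨a, ha, rfl⟩

/-- The map `η` is an MT-morphism from `M` to the powerset of its space of atoms. -/
def etaHom (M : Type u) [MTAlgebra M] : MTHom M (Set (Atoms M)) where
  toFun := eta
  map_sInf' S := by
    ext x
    simp [eta]
  map_sSup' S := by
    ext x
    simp [eta, atom_le_sSup_iff x.property]
  map_box_le' a := interior_maximal (eta_mono (MTAlgebra.box_le a)) (isOpen_eta (isOpenElt_box a))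

theorem theta_apply (x : Atoms M) (u : OpenElts M) : theta x u ↔ x.val ≤ u.val := Iff.rfl

/-- An atom `x` is a join of weakly locally closed elements, hence lies below one of them, `s ⊓ c ≤
x`. An atom in the same opens as `x` is below `s`, and below `c` because it is not below the open
`cᶜ`. -/
theorem IsT0.theta_injective (h : IsT0 M) : Function.Injective (theta (M := M)) := by
  have key : ∀ x y : Atoms M, theta x = theta y → y.val ≤ x.val := fun x y hxy => by
    have hop : ∀ u : M, IsOpenElt u → (x.val ≤ u ↔ y.val ≤ u) := fun u hu =>
      iff_of_eq (DFunLike.congr_fun hxy (⟨u, hu⟩ : OpenElts M))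
    obtain ⟨S, hS, hxS⟩ := h x.val
    obtain ⟨b, hb, hxb⟩ := atom_le_sSup x.property hxS.le
    refine le_trans ?_ ((le_sSup hb).trans hxS.ge)
    obtain ⟨s, c, ⟨U, hU, rfl⟩, hc, rfl⟩ := hS b hb
    refine le_inf (le_sInf fun u hu => (hop u (hU u hu)).1
      (hxb.trans (inf_le_left.trans (sInf_le hu)))) ?_
    by_contra hyc
    have := (hop _ (isClosedElt_iff.1 hc)).2 ((atom_le_compl_iff y.property).2 hyc)
    exact (atom_le_compl_iff x.property).1 this (hxb.trans inf_le_right)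
  intro x y hxy
  exact Atoms.ext (le_antisymm (key y x hxy.symm) (key x y hxy))

/-- A point `p` is determined by the largest open `u` not in it. As `p` is a proper filter, `uᶜ` is
join-irreducible among the closed elements, so `uᶜ = ◇ x` for an atom `x`. Then `u = □ xᶜ`, and an
open `v` is in `p` exactly when `v ≰ xᶜ`, that is, when `x ≤ v`. -/
theorem IsSober.theta_surjective (h : IsSober M) : Function.Surjective (theta (M := M)) := by
  intro p
  let u : OpenElts M := sSup {v | ¬ p v}
  have hu : ∀ v, p v ↔ ¬ v ≤ u := fun v => by
    refine ⟨fun hv hvu => ?_, fun hv => ?_⟩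
    · obtain ⟨w, hw, hpw⟩ := (point_sSup p _).1 (point_mono p hvu hv)
      exact hw hpw
    · by_contra hn
      exact hv (le_sSup hn)
  have hcl : IsClosedElt (u.val)ᶜ := by
    rw [isClosedElt_iff, compl_compl]
    exact u.property
  have hirr : IsJoinIrreducibleClosed M (u.val)ᶜ := by
    refine ⟨hcl, fun hbot => ?_, fun a b ha hb hab => ?_⟩
    · have : (⊤ : M) ≤ u.val := (compl_eq_bot.1 hbot).ge
      exact (hu ⊤).1 (point_top p) this
    · have hle : (⟨aᶜ, isClosedElt_iff.1 ha⟩ ⊓ ⟨bᶜ, isClosedElt_iff.1 hb⟩ : OpenElts M) ≤ u := by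
        change aᶜ ⊓ bᶜ ≤ u.val
        rw [← compl_sup, ← hab, compl_compl]
      have hor : aᶜ ≤ u.val ∨ bᶜ ≤ u.val := by
        by_contra hn
        rw [not_or] at hn
        refine (hu _).1 ?_ hle
        exact (point_inf p _ _).2 ⟨(hu ⟨aᶜ, isClosedElt_iff.1 ha⟩).2 hn.1,
          (hu ⟨bᶜ, isClosedElt_iff.1 hb⟩).2 hn.2⟩
      refine hor.imp (fun h => le_antisymm ?_ ?_) fun h => le_antisymm ?_ ?_
      · exact compl_le_iff_compl_le.1 h
      · exact hab ▸ le_sup_left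
      · exact compl_le_iff_compl_le.1 h
      · exact hab ▸ le_sup_right
  obtain ⟨x, hx, hxu⟩ := h.2 _ hirr
  refine ⟨⟨x, hx⟩, DFunLike.ext _ _ fun v => propext ?_⟩
  rw [hu, theta_apply]
  have hux : u.val = MTAlgebra.box xᶜ := compl_injective hxu
  change x ≤ v.val ↔ ¬ v.val ≤ u.val
  have : v.val ≤ u.val ↔ v.val ≤ xᶜ := by
    rw [hux]
    refine ⟨fun h => h.trans (MTAlgebra.box_le _), fun h => ?_⟩
    rw [v.property]
    exact box_mono h
  rw [this, le_compl_comm, atom_le_compl_iff hx, not_not]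

/-- The homeomorphism `ϑ` between the atoms of a sober MT-algebra and the points of its frame of
open elements. -/
noncomputable def thetaHomeo (h : IsSober M) : Atoms M ≃ₜ Locale.PT (OpenElts M) :=
  (Equiv.ofBijective theta ⟨h.1.theta_injective, h.theta_surjective⟩).toHomeomorph fun s => by
    change IsOpen (theta ⁻¹' s) ↔ IsOpen s
    constructor
    · rintro ⟨a, ha, has⟩
      refine ⟨⟨a, ha⟩, h.theta_surjective.preimage_injective (Eq.trans ?_ has)⟩
      rfl
    · rintro ⟨a, rfl⟩
      exact ⟨a.val, a.property, rfl⟩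

/-- The open elements above a compact element form a Scott-open filter. -/
theorem IsCompactElt.isScottOpenFilter {k : M} (hk : IsCompactElt k) :
    IsScottOpenFilter {v : OpenElts M | k ≤ v.val} where
  top_mem := (le_top : k ≤ (⊤ : M))
  mem_of_le {a b} ha hab := le_trans (show k ≤ a.val from ha) hab
  inf_mem {a b} ha hb := (le_inf ha hb : k ≤ a.val ⊓ b.val)
  exists_finite S hS := by
    obtain ⟨T, hT, hTf, hkT⟩ := hk (OpenElts.val '' S)
      (by rintro _ ⟨u, _, rfl⟩; exact u.property) hS
    refine ⟨OpenElts.val ⁻¹' T, fun u hu => ?_,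
      hTf.preimage (fun a _ b _ h => OpenElts.ext h), hkT.trans (sSup_le_sSup fun t ht => ?_)⟩
    · obtain ⟨w, hw, hwu⟩ := hT hu
      exact OpenElts.ext hwu ▸ hw
    · obtain ⟨w, _, rfl⟩ := hT ht
      exact ⟨w, ht, rfl⟩

/-- This replaces spatiality. If `k ≰ u`, Hofmann–Mislove gives a point containing all opens above
`k` but not `u`; by sobriety it comes from an atom, which lies below `k` because `k` is saturated.
-/
theorem IsKS.le_of_eta_subset (hM : IsSober M) {k u : M} (hk : IsKS k) (hu : IsOpenElt u)
    (h : eta k ⊆ eta u) : k ≤ u := by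
  by_contra hn
  obtain ⟨p, hp, hpu⟩ := hk.1.isScottOpenFilter.exists_point (c := ⟨u, hu⟩) hn
  obtain ⟨x, rfl⟩ := hM.theta_surjective p
  obtain ⟨S, hS, rfl⟩ := hk.2
  exact hpu (h (show x ∈ eta (sInf S) from le_sInf fun v hv => hp ⟨v, hS v hv⟩ (sInf_le hv)))

theorem IsSaturatedElt.eta {a : M} (ha : IsSaturatedElt a) : IsSaturatedElt (eta a) := by
  obtain ⟨S, hS, rfl⟩ := ha
  refine ⟨MTDuality.eta '' S, ?_, (etaHom M).map_sInf' S⟩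
  rintro _ ⟨u, hu, rfl⟩
  exact isOpenElt_iff_isOpen.2 (isOpen_eta (hS u hu))

theorem IsKS.eta (hM : IsSober M) {k : M} (hk : IsKS k) : IsKS (eta k) := by
  refine ⟨fun S hS hkS => ?_, hk.2.eta⟩
  have h1 : k ≤ sSup {u : M | IsOpenElt u ∧ MTDuality.eta u ∈ S} := by
    refine hk.le_of_eta_subset hM (isOpenElt_sSup fun u hu => hu.1) fun x hx => ?_
    obtain ⟨U, hU, hxU⟩ := hkS hx
    obtain ⟨u, hu, rfl⟩ := isOpenElt_iff_isOpen.1 (hS U hU)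
    exact le_trans (show x.val ≤ u from hxU) (le_sSup ⟨hu, hU⟩)
  obtain ⟨T, hT, hTf, hkT⟩ := hk.1 _ (fun u hu => hu.1) h1
  refine ⟨MTDuality.eta '' T, ?_, hTf.image _, ?_⟩
  · rintro _ ⟨u, hu, rfl⟩
    exact (hT hu).2
  · exact (eta_mono hkT).trans ((etaHom M).map_sSup' T).le

/-- The saturation of `k`, the meet of the opens above it, has the same open upper bounds as `k` and
so stays compact. -/
theorem IsCompactElt.exists_isKS {k : M} (hk : IsCompactElt k) :
    ∃ m, IsKS m ∧ k ≤ m ∧ ∀ u, IsOpenElt u → k ≤ u → m ≤ u := by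
  refine ⟨sInf {u | IsOpenElt u ∧ k ≤ u}, ⟨fun S hS h => ?_, _, fun u hu => hu.1, rfl⟩,
    le_sInf fun u hu => hu.2, fun u hu h => sInf_le ⟨hu, h⟩⟩
  obtain ⟨T, hT, hTf, hkT⟩ := hk S hS ((le_sInf fun u hu => hu.2).trans h)
  exact ⟨T, hT, hTf, sInf_le ⟨isOpenElt_sSup fun u hu => hS u (hT hu), hkT⟩⟩

theorem IsCompactElt.sup {k m : M} (hk : IsCompactElt k) (hm : IsCompactElt m) :
    IsCompactElt (k ⊔ m) := fun S hS h => by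
  obtain ⟨T, hT, hTf, hkT⟩ := hk S hS (le_sup_left.trans h)
  obtain ⟨T', hT', hTf', hmT⟩ := hm S hS (le_sup_right.trans h)
  exact ⟨T ∪ T', Set.union_subset hT hT', hTf.union hTf', by
    rw [sSup_union]; exact sup_le_sup hkT hmT⟩

theorem wayBelow_of_isCompactElt {a b : OpenElts M} {k : M} (hk : IsCompactElt k)
    (hak : a.val ≤ k) (hkb : k ≤ b.val) : WayBelow a b := fun S hS => by
  obtain ⟨T, hT, hTf, h⟩ := hk.isScottOpenFilter.exists_finite S (hkb.trans hS)
  exact ⟨T, hT, hTf, hak.trans h⟩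

theorem nested_sSup_of_finite {T : Set (OpenElts M)} (hT : T.Finite) {b : M}
    (h : ∀ v ∈ T, Nested v.val b) : Nested (sSup T).val b := by
  induction T, hT using Set.Finite.induction_on with
  | empty =>
    refine ⟨⊥, fun S _ _ => ⟨∅, Set.empty_subset _, Set.finite_empty, bot_le⟩, ?_, bot_le⟩
    rw [OpenElts.coe_sSup, Set.image_empty, sSup_empty]
  | @insert v s _ _ ih =>
    obtain ⟨k, hk, hvk, hkb⟩ := h v (Set.mem_insert v s)
    obtain ⟨m, hm, hsm, hmb⟩ := ih fun w hw => h w (Set.mem_insert_of_mem v hw)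
    refine ⟨k ⊔ m, hk.sup hm, ?_, sup_le hkb hmb⟩
    rw [OpenElts.coe_sSup, Set.image_insert_eq, sSup_insert]
    exact sup_le_sup hvk hsm

theorem IsLocallyCompact.eq_sSup (hM : IsLocallyCompact M) (b : OpenElts M) :
    b = sSup {v : OpenElts M | Nested v.val b.val} := by
  refine OpenElts.ext ((hM b.val b.property).trans ?_)
  rw [OpenElts.coe_sSup]
  congr 1
  ext v
  exact ⟨fun hv => ⟨⟨v, hv.1⟩, hv.2, rfl⟩, by rintro ⟨w, hw, rfl⟩; exact ⟨w.property, hw⟩⟩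

/-- Converse to `wayBelow_of_isCompactElt`. Finitely many opens nested in `b` cover `a`; the join of
their compact witnesses is compact, and saturating it does not leave `b`. -/
theorem IsLocallyCompact.exists_isKS (hM : IsLocallyCompact M) {a b : OpenElts M}
    (h : WayBelow a b) : ∃ k : M, IsKS k ∧ a.val ≤ k ∧ k ≤ b.val := by
  obtain ⟨T, hT, hTf, haT⟩ := h _ (hM.eq_sSup b).le
  obtain ⟨k, hk, hTk, hkb⟩ := nested_sSup_of_finite hTf hT
  obtain ⟨m, hm, hkm, hmu⟩ := hk.exists_isKS
  exact ⟨m, hm, (show a.val ≤ (sSup T).val from haT).trans (hTk.trans hkm),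
    hmu _ b.property hkb⟩

theorem IsLocallyCompact.isContinuousFrame (hM : IsLocallyCompact M) :
    IsContinuousFrame (OpenElts M) := fun b => by
  refine le_antisymm ?_ (sSup_le fun x hx => WayBelow.le hx)
  conv_lhs => rw [hM.eq_sSup b]
  refine sSup_le fun v hv => le_sSup ?_
  obtain ⟨k, hk, hvk, hkb⟩ := hv
  exact wayBelow_of_isCompactElt hk hvk hkb

theorem IsLocallyCompact.wayBelow_onOpens (hM : IsLocallyCompact M) {N : Type u} [MTAlgebra N]
    (f : MTHom M N) (hf : ∀ a : M, IsKS a → IsKS (f a)) {a b : OpenElts M} (h : WayBelow a b) :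
    WayBelow (f.onOpens a) (f.onOpens b) := by
  obtain ⟨k, hk, hak, hkb⟩ := hM.exists_isKS h
  exact wayBelow_of_isCompactElt (hf k hk).1 (OrderHomClass.mono f hak) (OrderHomClass.mono f hkb)

theorem IsLocallyCompact.wayBelowStable (hM : IsLocallyCompact M)
    (h : ∀ k m : M, IsKS k → IsKS m → IsKS (k ⊓ m)) : WayBelowStable (OpenElts M) :=
  fun a b c hab hac => by
    obtain ⟨k, hk, hak, hkb⟩ := hM.exists_isKS hab
    obtain ⟨m, hm, ham, hmc⟩ := hM.exists_isKS hac
    exact wayBelow_of_isCompactElt (h k m hk hm).1 (le_inf hak ham) (inf_le_inf hkb hmc)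

theorem IsCompactElt.isCompactFrame (h : IsCompactElt (⊤ : M)) : IsCompactFrame (OpenElts M) :=
  fun S hS => by
    obtain ⟨T, hT, hTf, hle⟩ := h.isScottOpenFilter.exists_finite S
      (show (⊤ : OpenElts M) ≤ sSup S from hS.le)
    exact ⟨T, hT, hTf, (top_le_iff.1 (show (⊤ : OpenElts M) ≤ sSup T from hle)).symm⟩

end Atoms

/-! ### Powersets of spaces -/

section PowersetObjects

variable (X : Type u) [TopologicalSpace X]

theorem isLocallyCompact_powerset [LocallyCompactSpace X] : IsLocallyCompact (Set X) := by
  intro U hU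
  refine Set.Subset.antisymm (fun x hx => ?_) (sSup_le ?_)
  · obtain ⟨K, hKx, hKU, hK⟩ := local_compact_nhds
      ((isOpenElt_iff_isOpen.1 hU).mem_nhds hx)
    exact ⟨interior K, ⟨isOpenElt_iff_isOpen.2 isOpen_interior, K,
      isCompact_iff_isCompactElt.1 hK, interior_subset, hKU⟩, mem_interior_iff_mem_nhds.2 hKx⟩
  · rintro V ⟨_, K, _, hVK, hKU⟩
    exact hVK.trans hKU

variable {X}

theorem diamond_eq_closure (A : Set X) : diamond A = closure A :=
  closure_eq_compl_interior_compl.symm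

theorem isClosedElt_iff_isClosed {A : Set X} : IsClosedElt A ↔ IsClosed A := by
  rw [isClosedElt_iff, isOpenElt_iff_isOpen, isOpen_compl_iff]

variable (X)

/-- Each singleton is the saturation of `{x}` intersected with its closure: a point in both is
topologically indistinguishable from `x`. -/
theorem isT0_powerset [T0Space X] : IsT0 (Set X) := by
  intro A
  refine ⟨(fun x => {x}) '' A, ?_, ?_⟩
  · rintro _ ⟨x, _, rfl⟩
    refine ⟨sInf {U | IsOpenElt U ∧ x ∈ U}, closure {x}, ⟨_, fun U hU => hU.1, rfl⟩,
      isClosedElt_iff_isClosed.2 isClosed_closure, ?_⟩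
    refine Set.Subset.antisymm (Set.singleton_subset_iff.2
      ⟨fun U hU => hU.2, subset_closure rfl⟩) ?_
    rintro y ⟨hy, hyx⟩
    have h1 : y ⤳ x := specializes_iff_forall_open.2 fun U hU hxU =>
      hy U ⟨isOpenElt_iff_isOpen.2 hU, hxU⟩
    exact (h1.antisymm (specializes_iff_mem_closure.2 hyx)).eq
  · rw [Set.sSup_eq_sUnion, Set.sUnion_image, Set.biUnion_of_singleton]

theorem isSober_powerset [T0Space X] [QuasiSober X] : IsSober (Set X) := by
  refine ⟨isT0_powerset X, fun Z hZ => ?_⟩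
  have hcl := isClosedElt_iff_isClosed.1 hZ.1
  have hirr : IsIrreducible Z := by
    refine ⟨Set.nonempty_iff_ne_empty.2 hZ.2.1,
      isPreirreducible_iff_isClosed_union_isClosed.2 fun A B hA hB hAB => ?_⟩
    -- Join-irreducibility speaks of equalities, so the cover of `Z` by `A` and `B` is first cut
    -- down to `Z`.
    have := hZ.2.2 (Z ∩ A) (Z ∩ B) (isClosedElt_iff_isClosed.2 (hcl.inter hA))
      (isClosedElt_iff_isClosed.2 (hcl.inter hB))
      (by
        change Z = Z ∩ A ∪ Z ∩ B
        rw [← Set.inter_union_distrib_left, Set.inter_eq_left.2 hAB])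
    exact this.imp (fun h => Set.inter_eq_left.1 h.symm) fun h => Set.inter_eq_left.1 h.symm
  obtain ⟨x, hx⟩ := QuasiSober.sober hirr hcl
  exact ⟨{x}, Set.isAtom_singleton x, (diamond_eq_closure {x}).symm ▸ hx.symm⟩

end PowersetObjects

/-! ### Transfer along isomorphisms -/

section Transfer

theorem isProperCont_homeomorph {X Y : Type u} [TopologicalSpace X] [TopologicalSpace Y]
    (e : X ≃ₜ Y) : IsProperCont e := fun _ hK => e.isCompact_preimage.2 hK.1

theorem LCSob_of_homeomorph {X Y : Type u} [TopologicalSpace X] [TopologicalSpace Y]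
    (e : X ≃ₜ Y) (h : LCSob (TopCat.of Y)) : LCSob (TopCat.of X) := by
  obtain ⟨h1, h2, h3⟩ := h
  change LocallyCompactSpace Y at h1
  change T0Space Y at h2
  change QuasiSober Y at h3
  exact ⟨e.isOpenEmbedding.locallyCompactSpace, e.isEmbedding.t0Space, e.isOpenEmbedding.quasiSober⟩

theorem StLCSob_of_homeomorph {X Y : Type u} [TopologicalSpace X] [TopologicalSpace Y]
    (e : X ≃ₜ Y) (h : StLCSob (TopCat.of Y)) : StLCSob (TopCat.of X) := by
  refine ⟨LCSob_of_homeomorph e h.1, fun K H hK hH => ?_⟩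
  have hs := isProperCont_homeomorph e.symm
  have he := isProperCont_homeomorph e
  have := h.2 _ _ (hs.preimage e.symm.continuous hK) (hs.preimage e.symm.continuous hH)
  have h2 := he.preimage e.continuous this
  rw [← Set.preimage_inter, ← Set.preimage_comp, e.symm_comp_self] at h2
  exact h2

variable {L L' : Type u} [Order.Frame L] [Order.Frame L']

theorem WayBelow.orderIso (e : L ≃o L') {a b : L} (h : WayBelow a b) : WayBelow (e a) (e b) :=
  fun S hS => by
    obtain ⟨T, hT, hTf, haT⟩ := h (e ⁻¹' S) (by
      rw [← e.le_iff_le, e.map_sSup, ← sSup_image, Set.image_preimage_eq _ e.surjective]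
      exact hS)
    refine ⟨e '' T, Set.image_subset_iff.2 hT, hTf.image e, ?_⟩
    rw [sSup_image, ← e.map_sSup]
    exact e.monotone haT

theorem wayBelow_orderIso_iff (e : L ≃o L') {a b : L} : WayBelow (e a) (e b) ↔ WayBelow a b :=
  ⟨fun h => by simpa using h.orderIso e.symm, fun h => h.orderIso e⟩

theorem IsContinuousFrame.orderIso (e : L ≃o L') (h : IsContinuousFrame L) :
    IsContinuousFrame L' := fun a => by
  refine le_antisymm ?_ (sSup_le fun x hx => WayBelow.le hx)
  rw [← e.symm.le_iff_le, h (e.symm a)]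
  refine sSup_le fun x hx => ?_
  rw [e.le_symm_apply]
  exact le_sSup (by simpa using WayBelow.orderIso e hx)

theorem WayBelowStable.orderIso (e : L ≃o L') (h : WayBelowStable L) :
    WayBelowStable L' := fun a b c hab hac => by
  rw [← wayBelow_orderIso_iff e.symm, map_inf]
  exact h _ _ _ (hab.orderIso e.symm) (hac.orderIso e.symm)

theorem isCompactFrame_iff : IsCompactFrame L ↔ WayBelow (⊤ : L) ⊤ := by
  simp only [IsCompactFrame, WayBelow, top_le_iff, eq_comm]

theorem IsCompactFrame.orderIso (e : L ≃o L') (h : IsCompactFrame L) : IsCompactFrame L' := by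
  rw [isCompactFrame_iff] at *
  simpa using h.orderIso e

end Transfer

/-! ### The functors on objects -/

theorem CFrm_functorO {M : MT.{u}} (h : LCSobMT M) : CFrm (functorO.obj M) :=
  h.1.isContinuousFrame

theorem StCFrm_functorO {M : MT.{u}} (h : StLCMT M) : StCFrm (functorO.obj M) :=
  ⟨CFrm_functorO h.1, h.1.1.wayBelowStable h.2⟩

theorem StKFrm_functorO {M : MT.{u}} (h : StKMT M) : StKFrm (functorO.obj M) :=
  ⟨StCFrm_functorO h.1, h.2.isCompactFrame⟩

theorem LCSob_functorPt {L : Frm.{u}} (h : CFrm L) : LCSob (functorPt.obj (op L)) :=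
  LCSob_points h

theorem StLCSob_functorPt {L : Frm.{u}} (h : StCFrm L) : StLCSob (functorPt.obj (op L)) :=
  StLCSob_points h.1 h.2

theorem StKSob_functorPt {L : Frm.{u}} (h : StKFrm L) : StKSob (functorPt.obj (op L)) :=
  ⟨StLCSob_functorPt h.1, h.2.compactSpace⟩

theorem LCSobMT_functorP {X : TopCat.{u}} (h : LCSob X) : LCSobMT (functorP.obj (op X)) := by
  obtain ⟨h1, h2, h3⟩ := h
  exact ⟨isLocallyCompact_powerset X, isSober_powerset X⟩

theorem StLCMT_functorP {X : TopCat.{u}} (h : StLCSob X) : StLCMT (functorP.obj (op X)) := by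
  refine ⟨LCSobMT_functorP h.1, fun (K H : Set X) hK hH => ?_⟩
  exact isKS_iff_isCompactSaturated.2
    (h.2 K H (isKS_iff_isCompactSaturated.1 hK) (isKS_iff_isCompactSaturated.1 hH))

theorem StKMT_functorP {X : TopCat.{u}} (h : StKSob X) : StKMT (functorP.obj (op X)) := by
  have := h.2
  exact ⟨StLCMT_functorP h.1, isCompact_iff_isCompactElt.1 (isCompact_univ (X := X))⟩

theorem SMT_functorP (X : TopCat.{u}) : SMT (functorP.obj (op X)) :=
  (inferInstance : IsAtomic (Set X))

theorem LCSob_functorAt {M : MT.{u}} (h : LCSobMT M) : LCSob (functorAt.obj (op M)) :=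
  LCSob_of_homeomorph (thetaHomeo h.2) (LCSob_functorPt (CFrm_functorO h))

theorem StLCSob_functorAt {M : MT.{u}} (h : StLCMT M) : StLCSob (functorAt.obj (op M)) :=
  StLCSob_of_homeomorph (thetaHomeo h.1.2) (StLCSob_functorPt (StCFrm_functorO h))

theorem StKSob_functorAt {M : MT.{u}} (h : StKMT M) : StKSob (functorAt.obj (op M)) := by
  have : CompactSpace (Locale.PT (OpenElts M)) := (StKSob_functorPt (StKFrm_functorO h)).2
  exact ⟨StLCSob_functorAt h.1, (thetaHomeo h.1.1.2).symm.compactSpace⟩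

/-- The open elements of the powerset of `X` are the open sets of `X`. -/
def openEltsOrderIso (X : Type u) [TopologicalSpace X] :
    OpenElts (Set X) ≃o TopologicalSpace.Opens X where
  toFun U := ⟨U.val, isOpenElt_iff_isOpen.1 U.property⟩
  invFun U := ⟨U.1, isOpenElt_iff_isOpen.2 U.2⟩
  left_inv _ := rfl
  right_inv _ := rfl
  map_rel_iff' := Iff.rfl

theorem CFrm_functorOmega {X : TopCat.{u}} (h : LCSob X) : CFrm (functorOmega.obj (op X)) :=
  IsContinuousFrame.orderIso (openEltsOrderIso X) (CFrm_functorO (LCSobMT_functorP h))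

theorem StCFrm_functorOmega {X : TopCat.{u}} (h : StLCSob X) :
    StCFrm (functorOmega.obj (op X)) :=
  ⟨CFrm_functorOmega h.1,
    WayBelowStable.orderIso (openEltsOrderIso X) (StCFrm_functorO (StLCMT_functorP h)).2⟩

theorem StKFrm_functorOmega {X : TopCat.{u}} (h : StKSob X) :
    StKFrm (functorOmega.obj (op X)) :=
  ⟨StCFrm_functorOmega h.1,
    IsCompactFrame.orderIso (openEltsOrderIso X) (StKFrm_functorO (StKMT_functorP h)).2⟩

/-! ### The functors on morphisms -/

theorem properFrm_functorO_map {M N : MT.{u}} (f : M ⟶ N) (hM : LCSobMT M) (hf : properMT f) :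
    properFrm (functorO.map f) := fun _ _ h => hM.1.wayBelow_onOpens f.hom' hf h

theorem properTop_functorPt_map {L L' : Frm.{u}} (f : L ⟶ L') (hL : CFrm L) (hf : properFrm f) :
    properTop (functorPt.map f.op) := isProperCont_comp hL f.hom hf

theorem properMT_functorP_map {X Y : TopCat.{u}} (f : X ⟶ Y) (hf : properTop f) :
    properMT (functorP.map f.op) := fun _ hK =>
  isKS_iff_isCompactSaturated.2
    (IsProperCont.preimage hf f.hom.continuous (isKS_iff_isCompactSaturated.1 hK))

/-- The map of atoms induced by an MT-morphism. -/
def MTHom.onAtoms {M N : Type u} [MTAlgebra M] [MTAlgebra N] (f : MTHom M N) (y : Atoms N) :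
    Atoms M := ⟨lowerAdjoint f y.val, isAtom_lowerAdjoint f y.property⟩

theorem MTHom.onAtoms_mem_eta {M N : Type u} [MTAlgebra M] [MTAlgebra N] (f : MTHom M N)
    (y : Atoms N) (a : M) : f.onAtoms y ∈ eta a ↔ y ∈ eta (f a) :=
  lowerAdjoint_le_iff f y.val a

theorem theta_onAtoms {M N : Type u} [MTAlgebra M] [MTAlgebra N] (f : MTHom M N) (y : Atoms N) :
    theta (f.onAtoms y) = (theta y).comp f.onOpens :=
  DFunLike.ext _ _ fun u => propext (f.onAtoms_mem_eta y u.val)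

/-- The homeomorphisms `ϑ` conjugate the map on atoms into `pt (𝒪 f)`, which is already known to be
proper. -/
theorem properTop_functorAt_map {M N : MT.{u}} (f : M ⟶ N) (hM : LCSobMT M) (hN : LCSobMT N)
    (hf : properMT f) : properTop (functorAt.map f.op) := by
  have h1 : IsProperCont fun p : Locale.PT (OpenElts N) =>
      (p.comp f.hom'.onOpens : Locale.PT (OpenElts M)) :=
    isProperCont_comp (CFrm_functorO hM) f.hom'.onOpens (properFrm_functorO_map f hM hf)
  intro K (hK : IsCompactSaturated (X := Atoms M) K)
  let e := thetaHomeo hM.2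
  have h2 := h1 _ ((isProperCont_homeomorph e.symm).preimage e.symm.continuous hK)
  have h3 := (thetaHomeo hN.2).isCompact_preimage.2 h2
  refine (congrArg (IsCompact (X := Atoms N)) (Set.ext fun y => ?_)).mp h3
  have hy : e.symm ((theta y).comp f.hom'.onOpens) = f.hom'.onAtoms y := by
    rw [← theta_onAtoms]
    exact e.symm_apply_apply _
  exact iff_of_eq (congrArg (fun x : Atoms M => x ∈ K) hy)

theorem properFrm_functorOmega_map {X Y : TopCat.{u}} (f : X ⟶ Y) (hY : LCSob Y)
    (hf : properTop f) : properFrm (functorOmega.map f.op) := fun _ _ h =>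
  (properFrm_functorO_map (functorP.map f.op) (LCSobMT_functorP hY) (properMT_functorP_map f hf)
    _ _ (h.orderIso (openEltsOrderIso Y).symm)).orderIso (openEltsOrderIso X)

/-! ### Isomorphisms in the subcategories -/

/-- The subcategories need not be full, so the inverse has to be checked to be proper as well. -/
theorem Subcat.isIso_of_inverse {C : Type*} [Category C] {P : ObjectProperty C}
    {W : MorphismProperty C} [W.IsMultiplicative] {X Y : Subcat P W} (f : X ⟶ Y)
    (g : Y.obj ⟶ X.obj) (hg : W g) (h1 : f.hom ≫ g = 𝟙 X.obj) (h2 : g ≫ f.hom = 𝟙 Y.obj) :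
    IsIso f :=
  ⟨(⟨g, hg⟩ : Subcat.Hom Y X), Subcat.Hom.ext h1, Subcat.Hom.ext h2⟩

section Isos

variable {M N : Type u} [MTAlgebra M] [MTAlgebra N]

theorem IsOpenElt.map (f : MTHom M N) {a : M} (ha : IsOpenElt a) : IsOpenElt (f a) :=
  (f.onOpens ⟨a, ha⟩).property

theorem IsKS.of_inverse (f : MTHom M N) (g : MTHom N M) (hgf : ∀ a, g (f a) = a)
    (hfg : ∀ b, f (g b) = b) {b : N} (hb : IsKS b) : IsKS (g b) := by
  constructor
  · intro S hS h
    obtain ⟨T, hT, hTf, hbT⟩ := hb.1 (f '' S)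
      (by rintro _ ⟨u, hu, rfl⟩; exact (hS u hu).map f)
      (by rw [← map_sSup, ← hfg b]; exact OrderHomClass.mono f h)
    refine ⟨g '' T, ?_, hTf.image g, ?_⟩
    · rintro _ ⟨t, ht, rfl⟩
      obtain ⟨u, hu, rfl⟩ := hT ht
      rwa [hgf]
    · rw [← map_sSup]
      exact OrderHomClass.mono g hbT
  · obtain ⟨S, hS, rfl⟩ := hb.2
    exact ⟨g '' S, by rintro _ ⟨u, hu, rfl⟩; exact (hS u hu).map g, map_sInf g S⟩

/-- A surjective MT-morphism that reflects the order and preserves `□` has an inverse. -/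
theorem MTHom.exists_inverse (f : MTHom M N) (hle : ∀ a b, f a ≤ f b → a ≤ b)
    (hsurj : Function.Surjective f) (hbox : ∀ a, MTAlgebra.box (f a) ≤ f (MTAlgebra.box a)) :
    ∃ g : MTHom N M, (∀ a, g (f a) = a) ∧ ∀ b, f (g b) = b := by
  have hinj : Function.Injective f := fun a b h => le_antisymm (hle a b h.le) (hle b a h.ge)
  choose g hg using hsurj
  -- Since `f` reflects equality and order, each law for `g` is verified after applying `f`.
  refine ⟨⟨⟨⟨g, fun S => hinj ?_⟩, fun S => hinj ?_⟩, fun b => hle _ _ ?_⟩, fun a => hinj (hg _),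
    hg⟩
  · rw [hg, map_sInf, Set.image_image]
    simp [hg]
  · change f (g (sSup S)) = f (sSup (g '' S))
    rw [hg, map_sSup, Set.image_image]
    simp [hg]
  · change f (g (MTAlgebra.box b)) ≤ f (MTAlgebra.box (g b))
    rw [hg]
    simpa only [hg] using hbox (g b)

end Isos

theorem Subcat.isIso_of_mtHom {A : ObjectProperty MT.{u}} {M N : Subcat A properMT.{u}}
    (f : M ⟶ N) (hle : ∀ a b : M.obj, f.hom.hom' a ≤ f.hom.hom' b → a ≤ b)
    (hsurj : Function.Surjective f.hom.hom')
    (hbox : ∀ a, MTAlgebra.box (f.hom.hom' a) ≤ f.hom.hom' (MTAlgebra.box a)) : IsIso f := by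
  obtain ⟨g, hgf, hfg⟩ := f.hom.hom'.exists_inverse hle hsurj hbox
  refine Subcat.isIso_of_inverse f ⟨g⟩ (fun b hb => hb.of_inverse f.hom.hom' g hgf hfg) ?_ ?_
  · exact MT.Hom.ext (DFunLike.ext _ _ hgf)
  · exact MT.Hom.ext (DFunLike.ext _ _ hfg)

theorem Subcat.isIso_of_orderIso {B : ObjectProperty Frm.{u}} {L L' : Subcat B properFrm.{u}}
    (f : L ⟶ L') (e : L.obj ≃o L'.obj) (he : ∀ a, f.hom a = e a) : IsIso f := by
  refine Subcat.isIso_of_inverse f (Frm.ofHom (e.symm : FrameHom L'.obj L.obj))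
    (fun a b h => h.orderIso e.symm) ?_ ?_
  · ext a
    exact (congrArg e.symm (he a)).trans (e.symm_apply_apply a)
  · ext a
    exact (he _).trans (e.apply_symm_apply a)

theorem Subcat.isIso_of_homeomorph {S : ObjectProperty TopCat.{u}} {X Y : Subcat S properTop.{u}}
    (f : X ⟶ Y) (e : X.obj ≃ₜ Y.obj) (he : ∀ x, f.hom.hom x = e x) : IsIso f := by
  refine Subcat.isIso_of_inverse f (TopCat.ofHom ⟨e.symm, e.symm.continuous⟩)
    (isProperCont_homeomorph e.symm) ?_ ?_
  · ext x
    exact (congrArg e.symm (he x)).trans (e.symm_apply_apply x)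
  · ext x
    exact (he _).trans (e.apply_symm_apply x)

/-! ### The units and counits -/

theorem theta_image_eta {M : Type u} [MTAlgebra M] (hM : IsSober M) (u : OpenElts M) :
    theta '' eta u.val = zeta u := by
  refine Set.Subset.antisymm (Set.image_subset_iff.2 fun x hx => hx) fun p hp => ?_
  obtain ⟨x, rfl⟩ := hM.theta_surjective p
  exact ⟨x, hp, rfl⟩

/-- The MT-morphism `a ↦ {ϑ x | x ≤ a}` of a sober MT-algebra. -/
noncomputable def thetaEtaHom {M : Type u} [MTAlgebra M] (hM : IsSober M) :
    MTHom M (Set (Locale.PT (OpenElts M))) :=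
  (functorP.map (TopCat.ofHom ⟨(thetaHomeo hM).symm, (thetaHomeo hM).symm.continuous⟩).op).hom'.comp
    (etaHom M)

theorem thetaEtaHom_apply {M : Type u} [MTAlgebra M] (hM : IsSober M) (a : M) :
    thetaEtaHom hM a = theta '' eta a :=
  ((thetaHomeo hM).toEquiv.image_eq_preimage_symm (eta a)).symm

theorem IsKS.thetaEtaHom {M : Type u} [MTAlgebra M] (hM : IsSober M) {k : M} (hk : IsKS k) :
    IsKS (thetaEtaHom hM k) :=
  properMT_functorP_map (X := TopCat.of (Locale.PT (OpenElts M))) (Y := TopCat.of (Atoms M))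
    (TopCat.ofHom ⟨(thetaHomeo hM).symm, (thetaHomeo hM).symm.continuous⟩)
    (isProperCont_homeomorph (thetaHomeo hM).symm) _ (hk.eta hM)

theorem thetaEtaHom_naturality {M N : Type u} [MTAlgebra M] [MTAlgebra N] (hM : IsSober M)
    (hN : IsSober N) (f : MTHom M N) (a : M) : thetaEtaHom hN (f a) =
      (fun p : Locale.PT (OpenElts N) => (p.comp f.onOpens : Locale.PT (OpenElts M))) ⁻¹'
        thetaEtaHom hM a := by
  rw [thetaEtaHom_apply, thetaEtaHom_apply]
  ext p
  obtain ⟨y, rfl⟩ := hN.theta_surjective p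
  rw [Set.mem_preimage, ← theta_onAtoms, hN.1.theta_injective.mem_set_image,
    hM.1.theta_injective.mem_set_image, f.onAtoms_mem_eta]

/-- If `a ≰ b`, atomicity provides an atom below `a ⊓ bᶜ`. -/
theorem eta_subset_iff {M : Type u} [MTAlgebra M] (hM : SMT (MT.of M)) {a b : M} :
    eta a ⊆ eta b ↔ a ≤ b := by
  have : IsAtomic M := hM
  refine ⟨fun h => ?_, eta_mono⟩
  rw [← disjoint_compl_right_iff]
  by_contra hn
  rw [disjoint_iff] at hn
  obtain ⟨x, hx, hle⟩ := (eq_bot_or_exists_atom_le _).resolve_left hn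
  exact (atom_le_compl_iff hx).1 (hle.trans inf_le_right)
    (h (show (⟨x, hx⟩ : Atoms M) ∈ eta a from hle.trans inf_le_left))

theorem eta_surjective {M : Type u} [MTAlgebra M] : Function.Surjective (eta (M := M)) := fun A => by
  refine ⟨sSup (Atoms.val '' A), Set.ext fun x => ?_⟩
  change x.val ≤ _ ↔ _
  rw [atom_le_sSup_iff x.property]
  constructor
  · rintro ⟨_, ⟨y, hy, rfl⟩, hxy⟩
    rwa [Atoms.ext ((y.property.le_iff_eq x.property.1).1 hxy)]
  · exact fun hx => ⟨_, ⟨x, hx, rfl⟩, le_rfl⟩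

/-- The interior is `η u` for some open `u`; atomicity gives `u ≤ a`, hence `u ≤ □ a`. This is the
preservation of `□` needed to invert `η`. -/
theorem interior_eta_subset {M : Type u} [MTAlgebra M] (hM : SMT (MT.of M)) (a : M) :
    interior (eta a) ⊆ eta (MTAlgebra.box a) := by
  obtain ⟨u, hu, h⟩ : IsOpen (interior (eta a)) := isOpen_interior
  rw [← h]
  refine eta_mono (hu.le.trans (box_mono ((eta_subset_iff hM).1 ?_)))
  rw [h]
  exact interior_subset

/-- The homeomorphism `x ↦ {x}`. -/
noncomputable def singletonHomeo (X : Type u) [TopologicalSpace X] : X ≃ₜ Atoms (Set X) :=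
  (Equiv.ofBijective (fun x => ⟨{x}, Set.isAtom_singleton x⟩)
    ⟨fun _ _ h => Set.singleton_injective (congrArg Atoms.val h), fun A => by
      obtain ⟨x, hx⟩ := Set.isAtom_iff.1 A.property
      exact ⟨x, Atoms.ext hx.symm⟩⟩ : X ≃ Atoms (Set X)).toHomeomorph fun s => by
    have hpre : ∀ U : Set X, (fun x => (⟨{x}, Set.isAtom_singleton x⟩ : Atoms (Set X))) ⁻¹' eta U
        = U := fun U => Set.ext fun x => Set.singleton_subset_iff
    constructor
    · intro h
      refine ⟨_, isOpenElt_iff_isOpen.2 h, Set.ext fun A => ?_⟩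
      obtain ⟨x, hx⟩ := Set.isAtom_iff.1 A.property
      obtain rfl : A = ⟨{x}, Set.isAtom_singleton x⟩ := Atoms.ext hx
      exact Set.singleton_subset_iff
    · rintro ⟨U, hU, rfl⟩
      exact (hpre U).symm ▸ isOpenElt_iff_isOpen.1 hU

/-- The isomorphism `ζ` of a continuous frame with the open sets of its space of points. -/
noncomputable def zetaOrderIso {L : Type u} [Order.Frame L] (hL : IsContinuousFrame L) :
    L ≃o TopologicalSpace.Opens (Locale.PT L) where
  toEquiv := Equiv.ofBijective (fun a => ⟨zeta a, isOpen_zeta a⟩)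
    ⟨fun _ _ h => hL.zeta_injective (congrArg TopologicalSpace.Opens.carrier h), fun U => by
      obtain ⟨a, ha⟩ := exists_zeta_eq U.2
      exact ⟨a, TopologicalSpace.Opens.ext ha⟩⟩
  map_rel_iff' := ⟨hL.le_of_zeta_subset, zeta_mono⟩

/-- The isomorphism `ζ⁻¹`. -/
noncomputable def zetaInv {L : Type u} [Order.Frame L] (hL : IsContinuousFrame L) :
    OpenElts (Set (Locale.PT L)) ≃o L :=
  (openEltsOrderIso (Locale.PT L)).trans (zetaOrderIso hL).symm

theorem zetaInv_zeta {L : Type u} [Order.Frame L] (hL : IsContinuousFrame L) (a : L)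
    (h : IsOpenElt (zeta a)) : zetaInv hL ⟨zeta a, h⟩ = a :=
  (zetaOrderIso hL).symm_apply_apply a

theorem zeta_zetaInv {L : Type u} [Order.Frame L] (hL : IsContinuousFrame L)
    (U : OpenElts (Set (Locale.PT L))) : zeta (zetaInv hL U) = U.val := by
  obtain ⟨U, hU⟩ := U
  obtain ⟨a, rfl⟩ := exists_zeta_eq (isOpenElt_iff_isOpen.1 hU)
  rw [zetaInv_zeta]

theorem localePointOfSpacePoint_bijective (X : Type u) [TopologicalSpace X] [T0Space X]
    [QuasiSober X] : Function.Bijective (Locale.localePointOfSpacePoint X) := by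
  refine ⟨fun x y h => (inseparable_iff_forall_isOpen.2 fun U hU => ?_).eq, fun p => ?_⟩
  · exact iff_of_eq (DFunLike.congr_fun h (⟨U, hU⟩ : TopologicalSpace.Opens X))
  -- Sobriety of the powerset realizes `p` by an atom, that is, by a singleton.
  · obtain ⟨A, hA⟩ := (isSober_powerset X).theta_surjective
      (p.comp (openEltsOrderIso X : FrameHom (OpenElts (Set X)) (TopologicalSpace.Opens X)))
    obtain ⟨x, rfl⟩ := (singletonHomeo X).surjective A
    refine ⟨x, DFunLike.ext _ _ fun U => ?_⟩
    refine Eq.trans ?_ (DFunLike.congr_fun hA ((openEltsOrderIso X).symm U))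
    exact (propext (Set.singleton_subset_iff (a := x) (s := (U : Set X)))).symm

theorem zetaInv_thetaEtaHom {M : Type u} [MTAlgebra M] (hM : IsSober M)
    (hO : IsContinuousFrame (OpenElts M)) (u : OpenElts M) :
    zetaInv hO ((thetaEtaHom hM).onOpens u) = u := by
  refine hO.zeta_injective ((zeta_zetaInv hO _).trans ?_)
  exact (thetaEtaHom_apply hM u.val).trans (theta_image_eta hM u)

/-- The homeomorphism `x ↦ {U | x ∈ U}` of a sober space. -/
noncomputable def pointHomeo (X : Type u) [TopologicalSpace X] [T0Space X] [QuasiSober X] :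
    X ≃ₜ Locale.PT (TopologicalSpace.Opens X) :=
  (Equiv.ofBijective _ (localePointOfSpacePoint_bijective X)).toHomeomorph fun s => by
    constructor
    · intro h
      refine ⟨⟨_, h⟩, Set.ext fun p => ?_⟩
      obtain ⟨x, rfl⟩ := (localePointOfSpacePoint_bijective X).2 p
      exact Iff.rfl
    · rintro ⟨U, rfl⟩
      exact U.2

/-! ### The adjunctions -/

/-- The adjunction `𝒪 ⊣ 𝒫 ∘ pt`, restricted to classes `A` and `B` that these functors map into
each other. -/
noncomputable def oPtAdjunction {A : ObjectProperty MT.{u}} {B : ObjectProperty Frm.{u}}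
    (hA : A ≤ LCSobMT) (hB : B ≤ CFrm) (hO : ∀ M, A M → B (functorO.obj M))
    (hP : ∀ L, B L → A (functorPPt.obj L)) : OPtAdjunction A B where
  restrictsO := ⟨hO, fun f hM _ hf => properFrm_functorO_map f (hA _ hM) hf⟩
  restrictsPPt := ⟨hP, fun f hL _ hf =>
    properMT_functorP_map _ (properTop_functorPt_map f (hB _ hL) hf)⟩
  adj :=
    { unit :=
        { app := fun M => ⟨⟨thetaEtaHom (hA _ M.property).2⟩, fun _ hk => hk.thetaEtaHom _⟩
          naturality := fun M N f => by
            refine Subcat.Hom.ext (MT.Hom.ext (DFunLike.ext _ _ fun a => ?_))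
            exact thetaEtaHom_naturality _ _ f.hom.hom' a }
      counit :=
        { app := fun L => ⟨Frm.ofHom (zetaInv (hB _ L.property) :
              FrameHom (OpenElts (Set (Locale.PT L.obj))) L.obj),
            fun _ _ h => h.orderIso (zetaInv (hB _ L.property))⟩
          naturality := fun L L' f => by
            refine Subcat.Hom.ext (Frm.ext fun U => (hB _ L'.property).zeta_injective ?_)
            refine (zeta_zetaInv (hB _ L'.property) _).trans ?_
            exact (congrArg ((fun p : Locale.PT L'.obj => (p.comp f.hom.hom : Locale.PT L.obj)) ⁻¹' ·)
              (zeta_zetaInv (hB _ L.property) U)).symm }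
      left_triangle_components := fun M => by
        exact Subcat.Hom.ext (Frm.ext fun u => zetaInv_thetaEtaHom (hA _ M.property).2
          (hB _ (hO _ M.property)) u)
      right_triangle_components := fun L => by
        have hs : IsSober (Set (Locale.PT L.obj)) := (hA _ (hP _ L.property)).2
        refine Subcat.Hom.ext (MT.Hom.ext (DFunLike.ext _ _ fun (a : Set (Locale.PT L.obj)) => ?_))
        refine (congrArg ((fun p : Locale.PT L.obj => (p.comp
          (zetaInv (hB _ L.property) : FrameHom (OpenElts (Set (Locale.PT L.obj))) L.obj) :
            Locale.PT (OpenElts (Set (Locale.PT L.obj))))) ⁻¹' ·) (thetaEtaHom_apply hs a)).trans ?_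
        ext p
        -- Pulling `p` back along `ζ⁻¹` gives the point `ϑ {p}`, so the triangle identity reduces to
        -- `{p} ≤ a ↔ p ∈ a`.
        have hp : p.comp
            (zetaInv (hB _ L.property) : FrameHom (OpenElts (Set (Locale.PT L.obj))) L.obj) =
            theta (singletonHomeo _ p) := DFunLike.ext _ _ fun U => propext <|
          (Iff.of_eq (congrArg (p ∈ ·) (zeta_zetaInv (hB _ L.property) U))).trans
            Set.singleton_subset_iff.symm
        rw [Set.mem_preimage, hp, hs.1.theta_injective.mem_set_image]
        exact Set.singleton_subset_iff }
  unit_apply M a := thetaEtaHom_apply _ a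
  counit_apply L a := zetaInv_zeta _ a _

theorem isEquivalenceAdj_oPtAdjunction {A : ObjectProperty MT.{u}} {B : ObjectProperty Frm.{u}}
    (hA : A ≤ LCSobMT) (hB : B ≤ CFrm) (hO : ∀ M, A M → B (functorO.obj M))
    (hP : ∀ L, B L → A (functorPPt.obj L)) (hS : A ≤ SMT) :
    IsEquivalenceAdj (oPtAdjunction hA hB hO hP).adj := by
  constructor
  · rw [NatTrans.isIso_iff_isIso_app]
    intro M
    have happ := (oPtAdjunction hA hB hO hP).unit_apply M
    have hM := (hA _ M.property).2
    refine Subcat.isIso_of_mtHom _ (fun a b h => ?_) (fun (s : Set (Locale.PT _)) => ?_) fun a => ?_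
    · rw [happ, happ] at h
      exact (eta_subset_iff (hS _ M.property)).1 ((Set.image_subset_image_iff hM.1.theta_injective).1 h)
    · obtain ⟨a, ha⟩ := eta_surjective (theta ⁻¹' s)
      exact ⟨a, (happ a).trans (ha ▸ Set.image_preimage_eq s hM.theta_surjective)⟩
    · rw [happ, happ]
      change interior (thetaHomeo hM '' eta a) ⊆ thetaHomeo hM '' _
      rw [← (thetaHomeo hM).image_interior]
      exact Set.image_mono (interior_eta_subset (hS _ M.property) a)
  · rw [NatTrans.isIso_iff_isIso_app]
    exact fun L => Subcat.isIso_of_orderIso _ (zetaInv (hB _ L.property)) fun _ => rfl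

/-- The dual adjunction of `at` and `𝒫`, restricted to classes `A` and `S` that these functors map
into each other. -/
noncomputable def atPDualAdjunction {A : ObjectProperty MT.{u}} {S : ObjectProperty TopCat.{u}}
    (hA : A ≤ LCSobMT) (hAt : ∀ M, A M → S (functorAt.obj (op M)))
    (hP : ∀ X, S X → A (functorP.obj (op X))) : AtPDualAdjunction A S where
  restrictsAt := ⟨hAt, fun f hM hN hf => properTop_functorAt_map f (hA _ hM) (hA _ hN) hf⟩
  restrictsP := ⟨hP, fun f _ _ hf => properMT_functorP_map f hf⟩
  adj :=
    { unit :=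
        { app := fun M => ⟨⟨etaHom M.obj⟩, fun _ hk => hk.eta (hA _ M.property).2⟩
          naturality := fun M N f => by
            refine Subcat.Hom.ext (MT.Hom.ext (DFunLike.ext _ _ fun a => Set.ext fun y => ?_))
            exact (lowerAdjoint_le_iff f.hom.hom' y.val a).symm }
      counit :=
        { app := fun X => Quiver.Hom.op
            (⟨TopCat.ofHom ⟨singletonHomeo X.unop.obj, (singletonHomeo X.unop.obj).continuous⟩,
              isProperCont_homeomorph (singletonHomeo X.unop.obj)⟩ : Subcat.Hom X.unop
                ⟨functorAt.obj (op (functorP.obj (op X.unop.obj))), hAt _ (hP _ X.unop.property)⟩)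
          naturality := fun X Y f => by
            refine Quiver.Hom.unop_inj (Subcat.Hom.ext ?_)
            ext x
            refine Atoms.ext (eq_of_forall_ge_iff fun a => ?_)
            refine (lowerAdjoint_le_iff (functorP.map f.unop.hom.op).hom' _ a).trans ?_
            exact Set.singleton_subset_iff.trans (Set.singleton_subset_iff
              (a := f.unop.hom.hom x) (s := (a : Set X.unop.obj))).symm }
      left_triangle_components := fun M => by
        refine Quiver.Hom.unop_inj (Subcat.Hom.ext ?_)
        ext x
        refine Atoms.ext (eq_of_forall_ge_iff fun a => ?_)
        exact (lowerAdjoint_le_iff (etaHom M.obj) _ a).trans Set.singleton_subset_iff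
      right_triangle_components := fun X => by
        refine Subcat.Hom.ext (MT.Hom.ext (DFunLike.ext _ _ fun (a : Set X.unop.obj) => ?_))
        exact Set.ext fun x => Set.singleton_subset_iff }
  unit_apply _ _ := rfl
  counit_apply _ _ := rfl

theorem isEquivalenceAdj_atPDualAdjunction {A : ObjectProperty MT.{u}}
    {S : ObjectProperty TopCat.{u}}
    (hA : A ≤ LCSobMT) (hAt : ∀ M, A M → S (functorAt.obj (op M)))
    (hP : ∀ X, S X → A (functorP.obj (op X))) (hS : A ≤ SMT) :
    IsEquivalenceAdj (atPDualAdjunction hA hAt hP).adj := by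
  constructor
  · rw [NatTrans.isIso_iff_isIso_app]
    exact fun M => Subcat.isIso_of_mtHom _ (fun a b h => (eta_subset_iff (hS _ M.property)).1 h)
      eta_surjective (interior_eta_subset (hS _ M.property))
  · rw [NatTrans.isIso_iff_isIso_app]
    intro X
    have := Subcat.isIso_of_homeomorph ((atPDualAdjunction hA hAt hP).adj.counit.app X).unop
      (singletonHomeo X.unop.obj) fun _ => rfl
    exact (isIso_unop_iff _).1 this

/-- The dual adjunction of `pt` and `Ω`, restricted to classes `B` and `S` that these functors map
into each other. -/
noncomputable def ptOmegaDualAdjunction {B : ObjectProperty Frm.{u}} {S : ObjectProperty TopCat.{u}}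
    (hB : B ≤ CFrm) (hS : S ≤ LCSob) (hPt : ∀ L, B L → S (functorPt.obj (op L)))
    (hOm : ∀ X, S X → B (functorOmega.obj (op X))) : PtOmegaDualAdjunction B S where
  restrictsPt := ⟨hPt, fun f hL _ hf => properTop_functorPt_map f (hB _ hL) hf⟩
  restrictsOmega := ⟨hOm, fun f _ hY hf => properFrm_functorOmega_map f (hS _ hY) hf⟩
  adj :=
    { unit :=
        { app := fun L => ⟨Frm.ofHom (zetaOrderIso (hB _ L.property) :
              FrameHom L.obj (TopologicalSpace.Opens (Locale.PT L.obj))),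
            fun _ _ h => h.orderIso (zetaOrderIso (hB _ L.property))⟩
          naturality := fun _ _ _ => rfl }
      counit :=
        { app := fun X =>
            have := (hS _ X.unop.property).2.1
            have := (hS _ X.unop.property).2.2
            Quiver.Hom.op
            (⟨TopCat.ofHom ⟨pointHomeo X.unop.obj, (pointHomeo X.unop.obj).continuous⟩,
              isProperCont_homeomorph (pointHomeo X.unop.obj)⟩ : Subcat.Hom X.unop
                ⟨functorPt.obj (op (functorOmega.obj (op X.unop.obj))),
                  hPt _ (hOm _ X.unop.property)⟩)
          naturality := fun _ _ _ => rfl }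
      left_triangle_components := fun _ => rfl
      right_triangle_components := fun _ => rfl }
  unit_apply _ _ := rfl
  counit_apply _ _ := rfl

theorem isEquivalenceAdj_ptOmegaDualAdjunction {B : ObjectProperty Frm.{u}}
    {S : ObjectProperty TopCat.{u}}
    (hB : B ≤ CFrm) (hS : S ≤ LCSob) (hPt : ∀ L, B L → S (functorPt.obj (op L)))
    (hOm : ∀ X, S X → B (functorOmega.obj (op X))) :
    IsEquivalenceAdj (ptOmegaDualAdjunction hB hS hPt hOm).adj := by
  constructor
  · rw [NatTrans.isIso_iff_isIso_app]
    exact fun L => Subcat.isIso_of_orderIso _ (zetaOrderIso (hB _ L.property)) fun _ => rfl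
  · rw [NatTrans.isIso_iff_isIso_app]
    intro X
    have := (hS _ X.unop.property).2.1
    have := (hS _ X.unop.property).2.2
    have := Subcat.isIso_of_homeomorph
      ((ptOmegaDualAdjunction hB hS hPt hOm).adj.counit.app X).unop
      (pointHomeo X.unop.obj) fun _ => rfl
    exact (isIso_unop_iff _).1 this

theorem StLCMT_le : StLCMT.{u} ≤ LCSobMT := fun _ h => h.1

theorem StKMT_le : StKMT.{u} ≤ LCSobMT := fun _ h => h.1.1

theorem StCFrm_le : StCFrm.{u} ≤ CFrm := fun _ h => h.1

theorem StKFrm_le : StKFrm.{u} ≤ CFrm := fun _ h => h.1.1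

theorem StLCSob_le : StLCSob.{u} ≤ LCSob := fun _ h => h.1

theorem StKSob_le : StKSob.{u} ≤ LCSob := fun _ h => h.1.1

end MTDuality

theorem mainTheorem7 :
    -- Hofmann-Lawson: locally compact sober MT-algebras, continuous frames, locally compact
    -- sober spaces
    (Nonempty (OPtAdjunction.{u} LCSobMT CFrm) ∧
      (∃ E : OPtAdjunction.{u} (LCSobMT ⊓ SMT) CFrm, IsEquivalenceAdj E.adj) ∧
      Nonempty (AtPDualAdjunction.{u} LCSobMT LCSob) ∧
      (∃ E : AtPDualAdjunction.{u} (LCSobMT ⊓ SMT) LCSob, IsEquivalenceAdj E.adj)) ∧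
    -- restriction to the stably locally compact case
    (Nonempty (OPtAdjunction.{u} StLCMT StCFrm) ∧
      (∃ E : OPtAdjunction.{u} (StLCMT ⊓ SMT) StCFrm, IsEquivalenceAdj E.adj) ∧
      Nonempty (AtPDualAdjunction.{u} StLCMT StLCSob) ∧
      (∃ E : AtPDualAdjunction.{u} (StLCMT ⊓ SMT) StLCSob, IsEquivalenceAdj E.adj) ∧
      (∃ E : PtOmegaDualAdjunction.{u} StCFrm StLCSob, IsEquivalenceAdj E.adj)) ∧
    -- restriction to the stably compact case
    (Nonempty (OPtAdjunction.{u} StKMT StKFrm) ∧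
      (∃ E : OPtAdjunction.{u} (StKMT ⊓ SMT) StKFrm, IsEquivalenceAdj E.adj) ∧
      Nonempty (AtPDualAdjunction.{u} StKMT StKSob) ∧
      (∃ E : AtPDualAdjunction.{u} (StKMT ⊓ SMT) StKSob, IsEquivalenceAdj E.adj) ∧
      (∃ E : PtOmegaDualAdjunction.{u} StKFrm StKSob, IsEquivalenceAdj E.adj)) := by
  -- Each clause only needs the functors to exchange the two classes of objects; in the spatial
  -- clauses, powersets are atomic.
  refine ⟨⟨?_, ?_, ?_, ?_⟩, ⟨?_, ?_, ?_, ?_, ?_⟩, ⟨?_, ?_, ?_, ?_, ?_⟩⟩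
  · exact ⟨oPtAdjunction le_rfl le_rfl (fun _ => CFrm_functorO)
      fun _ h => LCSobMT_functorP (LCSob_functorPt h)⟩
  · exact ⟨_, isEquivalenceAdj_oPtAdjunction inf_le_left le_rfl
      (fun _ h => CFrm_functorO h.1)
      (fun _ h => ⟨LCSobMT_functorP (LCSob_functorPt h), SMT_functorP _⟩) inf_le_right⟩
  · exact ⟨atPDualAdjunction le_rfl (fun _ => LCSob_functorAt) fun _ => LCSobMT_functorP⟩
  · exact ⟨_, isEquivalenceAdj_atPDualAdjunction inf_le_left
      (fun _ h => LCSob_functorAt h.1)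
      (fun _ h => ⟨LCSobMT_functorP h, SMT_functorP _⟩) inf_le_right⟩
  · exact ⟨oPtAdjunction StLCMT_le StCFrm_le (fun _ => StCFrm_functorO)
      fun _ h => StLCMT_functorP (StLCSob_functorPt h)⟩
  · exact ⟨_, isEquivalenceAdj_oPtAdjunction (inf_le_left.trans StLCMT_le) StCFrm_le
      (fun _ h => StCFrm_functorO h.1)
      (fun _ h => ⟨StLCMT_functorP (StLCSob_functorPt h), SMT_functorP _⟩) inf_le_right⟩
  · exact ⟨atPDualAdjunction StLCMT_le (fun _ => StLCSob_functorAt) fun _ => StLCMT_functorP⟩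
  · exact ⟨_, isEquivalenceAdj_atPDualAdjunction (inf_le_left.trans StLCMT_le)
      (fun _ h => StLCSob_functorAt h.1)
      (fun _ h => ⟨StLCMT_functorP h, SMT_functorP _⟩) inf_le_right⟩
  · exact ⟨_, isEquivalenceAdj_ptOmegaDualAdjunction StCFrm_le StLCSob_le (fun _ => StLCSob_functorPt)
      fun _ => StCFrm_functorOmega⟩
  · exact ⟨oPtAdjunction StKMT_le StKFrm_le (fun _ => StKFrm_functorO)
      fun _ h => StKMT_functorP (StKSob_functorPt h)⟩
  · exact ⟨_, isEquivalenceAdj_oPtAdjunction (inf_le_left.trans StKMT_le) StKFrm_le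
      (fun _ h => StKFrm_functorO h.1)
      (fun _ h => ⟨StKMT_functorP (StKSob_functorPt h), SMT_functorP _⟩) inf_le_right⟩
  · exact ⟨atPDualAdjunction StKMT_le (fun _ => StKSob_functorAt) fun _ => StKMT_functorP⟩
  · exact ⟨_, isEquivalenceAdj_atPDualAdjunction (inf_le_left.trans StKMT_le)
      (fun _ h => StKSob_functorAt h.1)
      (fun _ h => ⟨StKMT_functorP h, SMT_functorP _⟩) inf_le_right⟩
  · exact ⟨_, isEquivalenceAdj_ptOmegaDualAdjunction StKFrm_le StKSob_le (fun _ => StKSob_functorPt)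
      fun _ => StKFrm_functorOmega⟩
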